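/- Order the lattice points of the plane by $(i,j)\le(i',j')$ iff $i\ge i'$ and $j\le j'$. Let $Y\subseteq\{1,\dots,m\}\times\{1,\dots,n\}$ be a one-sided ladder-shaped region, i.e. $(1,n),(m,1)\in Y$, and whenever $(i,j)\in Y$, $1\le i'\le i$ and $1\le j'\le j$, also $(i',j')\in Y$. For $P,Q\in Y$ a path from $P$ to $Q$ is a maximal chain in $Y$ with end points $P$ (greatest element) and $Q$ (least element). A corner of a path $C$ is a point $(i,j)\in C$ such that $(i-1,j)\in C$ and $(i,j-1)\in C$. Let $W(P,Q)=\sum_{k\ge0}w_k(P,Q)t^k$, where $w_k(P,Q)$ is the number of paths from $P$ to $Q$ with exactly $k$ corners. For $l\ge1$ let $S_l=\{(b_1,\dots,b_l)\in\mathbb N^l : b_1<\dots<b_l\}$. For $\underline b,\underline c\in S_l$ define $A(\underline b;\underline c)$ recursively as follows. For $l=1$, $A(b_1;c_1)=1$ if $b_1=c_1$, and $0$ otherwise. For $l=2$, $A(b_1,b_2;c_1,c_2)=1$ if $b_2=c_2$ and $b_1\le c_1$, and $0$ otherwise. For $l>2$, $A(\underline b;\underline c)=0$ if $b_l\ne c_l$,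 and if $b_l=c_l$ then $$A(b_1,\dots,b_l;c_1,\dots,c_l)=\sum_{\underline{c}'\in S_{l-1},\ c'_i\le c_i\ (1\le i\le l-1)}A(b_1,\dots,b_{l-1};c'_1,\dots,c'_{l-1}).$$ Let $r\ge1$ and $\underline b=(b_1,\dots,b_r)\in S_r$ be such that $P_i=(i,n)$ and $Q_i=(m,b_i)$ lie in $Y$ for $i=1,\dots,r$. For $\underline c\in S_r$ let $W(n,m;\underline c)=\sum_{k\ge0}w_kt^k$, where $w_k$ is the number of families $(C_1,\dots,C_r)$ of pairwise disjoint paths in $Y$, $C_i$ from $P_i$ to $(m,c_i)$, with exactly $k$ corners in total (so $W(n,m;\underline c)=0$ if some $(m,c_i)\notin Y$). Then $$t^{-\binom r2}\det\bigl[W(P_i,Q_j)\bigr]_{i,j=1,\dots,r}=\sum_{\underline c\in S_r}A(\underline b;\underline c)\,(1-t)^{\sum_{i=1}^r(c_i-b_i)}\,W(n,m;\underline c),$$ where only finitely many $\underline c$ have $A(\underline b;\underline c)\neq0$, and all of these satisfy $c_i\ge b_i$ for all $i$. In particular, if $b_i=i$ for all $i$, then $$t^{-\binom r2}\det\bigl[W(P_i,Q_j)\bigr]_{i,j=1,\dots,r}=W(n,m;1,\dots,r).$$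 -/

import Mathlib

open Polynomial

/-- The partial order on lattice points: `(i, j) ≤ (i', j')` iff `i ≥ i'` and `j ≤ j'`. -/
def PtLE (p q : ℕ × ℕ) : Prop := q.1 ≤ p.1 ∧ p.2 ≤ q.2

/-- A one-sided ladder-shaped region: a subset of the rectangle `[1, m] × [1, n]` obtained by
cutting a staircase out of the upper right corner. It is closed under moving left and down inside
the rectangle, and it meets all `m` columns and all `n` rows. -/
structure IsOneSidedLadder (m n : ℕ) (Y : Finset (ℕ × ℕ)) : Prop where
  subset_rect : Y ⊆ Finset.Icc 1 m ×ˢ Finset.Icc 1 n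
  closed : ∀ p ∈ Y, ∀ q : ℕ × ℕ, 1 ≤ q.1 → 1 ≤ q.2 → q.1 ≤ p.1 → q.2 ≤ p.2 → q ∈ Y
  top_left_mem : (1, n) ∈ Y
  bottom_right_mem : (m, 1) ∈ Y

/-- A path in `Y` from `P` to `Q`: a maximal chain in `Y` with end points `P` and `Q`. -/
def IsPath (Y : Finset (ℕ × ℕ)) (P Q : ℕ × ℕ) (C : Finset (ℕ × ℕ)) : Prop :=
  Maximal (fun D : Finset (ℕ × ℕ) =>
    D ⊆ Y ∧ IsChain PtLE (D : Set (ℕ × ℕ)) ∧ P ∈ D ∧ Q ∈ D ∧ ∀ x ∈ D, PtLE Q x ∧ PtLE x P) C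

/-- The number of corners of `C`: elements `(i, j)` of `C` such that `(i - 1, j)` and `(i, j - 1)`
belong to `C`. (All points of a ladder have positive coordinates, so nothing is truncated.) -/
def numCorners (C : Finset (ℕ × ℕ)) : ℕ :=
  (C.filter fun p => (p.1 - 1, p.2) ∈ C ∧ (p.1, p.2 - 1) ∈ C).card

open Classical in
/-- The finite set of all paths in `Y` from `P` to `Q`. -/
noncomputable def paths (Y : Finset (ℕ × ℕ)) (P Q : ℕ × ℕ) : Finset (Finset (ℕ × ℕ)) :=
  Y.powerset.filter (IsPath Y P Q)

/-- `W(P, Q) = ∑ₖ wₖ(P, Q) tᵏ`, where `wₖ(P, Q)` is the number of paths with `k` corners. -/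
noncomputable def pathPoly (Y : Finset (ℕ × ℕ)) (P Q : ℕ × ℕ) : ℤ[X] :=
  ∑ C ∈ paths Y P Q, X ^ numCorners C

open Classical in
/-- The families of pairwise disjoint paths `C i` in `Y` from `P i` to `Q i`. -/
noncomputable def nonIntersecting (Y : Finset (ℕ × ℕ)) {r : ℕ} (P Q : Fin r → ℕ × ℕ) :
    Finset (Fin r → Finset (ℕ × ℕ)) :=
  (Fintype.piFinset fun i => paths Y (P i) (Q i)).filter
    fun C => ∀ i j, i ≠ j → Disjoint (C i) (C j)

/-- `W(𝐏, 𝐐) = ∑ₖ wₖ(𝐏, 𝐐) tᵏ`, where `wₖ(𝐏, 𝐐)` is the number of families of non-intersecting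
paths with `k` corners in total. -/
noncomputable def familyPoly (Y : Finset (ℕ × ℕ)) {r : ℕ} (P Q : Fin r → ℕ × ℕ) : ℤ[X] :=
  ∑ C ∈ nonIntersecting Y P Q, X ^ (∑ i, numCorners (C i))

/-- The points `P_1 = (1, n), …, P_r = (r, n)`; the index `i : Fin r` is `0`-based. -/
def startPt (n r : ℕ) (i : Fin r) : ℕ × ℕ := ((i : ℕ) + 1, n)

/-- The points `Q_i = (m, b_i)`. -/
def endPt (m : ℕ) {r : ℕ} (b : Fin r → ℕ) (i : Fin r) : ℕ × ℕ := (m, b i)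

/-- `W(n, m; b_1, …, b_r)`. -/
noncomputable def ladderW (Y : Finset (ℕ × ℕ)) (n m : ℕ) {r : ℕ} (b : Fin r → ℕ) : ℤ[X] :=
  familyPoly Y (startPt n r) (endPt m b)

/-- `W̃(n, m; b_1, …, b_r) = det [W(P_i, Q_j)]`. -/
noncomputable def ladderWTilde (Y : Finset (ℕ × ℕ)) (n m : ℕ) {r : ℕ} (b : Fin r → ℕ) : ℤ[X] :=
  (Matrix.of fun i j : Fin r => pathPoly Y (startPt n r i) (endPt m b j)).det

/-- `S_l`: the strictly increasing `l`-tuples of natural numbers. -/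
def incTuples (l : ℕ) : Set (Fin l → ℕ) := {b | StrictMono b}

open Classical in
/-- The coefficients `A(b; c)`. The recursion proper starts at length two; for length one the value
is the Kronecker delta, the value for which the recursive formula also holds at length two. -/
noncomputable def coeffA : (l : ℕ) → (Fin l → ℕ) → (Fin l → ℕ) → ℕ
  | 0, _, _ => 1
  | 1, b, c => if b 0 = c 0 then 1 else 0
  | 2, b, c => if b 1 = c 1 ∧ b 0 ≤ c 0 then 1 else 0
  | l + 3, b, c =>
    if b (Fin.last (l + 2)) = c (Fin.last (l + 2)) then
      ∑ c' ∈ (Finset.Iic (Fin.init c)).filter (· ∈ incTuples (l + 2)),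
        coeffA (l + 2) (Fin.init b) c'
    else 0

/-- `A(b; c) ≠ 0` forces `b ≤ c`, so the exponents `∑ (c_i - b_i)` that occur are nonnegative. -/
theorem le_of_coeffA_ne_zero : ∀ (l : ℕ) (b c : Fin l → ℕ), coeffA l b c ≠ 0 → b ≤ c
  | 0, _, _, _ => fun i => i.elim0
  | 1, b, c, h => by
    intro i
    fin_cases i
    simp only [coeffA] at h
    split_ifs at h with h1
    · exact h1.le
    · exact absurd rfl h
  | 2, b, c, h => by
    simp only [coeffA] at h
    split_ifs at h with h1
    · intro i
      fin_cases i
      · exact h1.2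
      · exact h1.1.le
    · exact absurd rfl h
  | l + 3, b, c, h => by
    simp only [coeffA] at h
    split_ifs at h with h1
    · classical
      obtain ⟨c', hc', hne⟩ := Finset.exists_ne_zero_of_sum_ne_zero h
      have h2 := le_of_coeffA_ne_zero (l + 2) _ _ hne
      have h3 : c' ≤ Fin.init c := Finset.mem_Iic.1 (Finset.mem_filter.1 hc').1
      intro i
      refine Fin.lastCases h1.le (fun j => ?_) i
      exact (h2 j).trans (h3 j)
    · exact absurd rfl h

/-- For fixed `b` only finitely many `c ∈ S_l` have `A(b; c) ≠ 0`, so sums over `S_l` weighted by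
`A(b; c)` are finite. -/
theorem finite_coeffA_ne_zero (l : ℕ) (b : Fin l → ℕ) :
    {c | c ∈ incTuples l ∧ coeffA l b c ≠ 0}.Finite := by
  match l, b with
  | 0, _ => exact Set.toFinite _
  | l + 1, b =>
    refine (Set.finite_Iic (fun _ : Fin (l + 1) => b (Fin.last l))).subset ?_
    rintro c ⟨hc, hA⟩
    have hlast : b (Fin.last l) = c (Fin.last l) := by
      match l, b, c, hA with
      | 0, b, c, hA =>
        simp only [coeffA] at hA
        split_ifs at hA with h1
        · exact h1
        · exact absurd rfl hA
      | 1, b, c, hA =>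
        simp only [coeffA] at hA
        split_ifs at hA with h1
        · exact h1.1
        · exact absurd rfl hA
      | l + 2, b, c, hA =>
        simp only [coeffA] at hA
        split_ifs at hA with h1
        · exact h1
        · exact absurd rfl hA
    intro i
    have hmono : StrictMono c := hc
    show c i ≤ b (Fin.last l)
    rw [hlast]
    exact hmono.monotone (Fin.le_last i)

/-! Sweep a vertical line through the ladder from left to right. In a free ℤ[t]-module let e_h be
the basis vector of height h, with e_0 = 0, and collect the path polynomials from P_i to column a
into a vector v_i. At column m the determinant is the coefficient of e_{b_1} ∧ … ∧ e_{b_r} in v_1 ∧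
… ∧ v_r. It is read off from an expansion valid in every column a ≥ k (`WedgeExpansion`): v_1 ∧ … ∧
v_k = t^{k choose 2} Σ_g W(g) N(g). Here W(g) counts disjoint families ending at heights g in column
a. With q = 1 - t, N(g) is the nested wedge: the sum of q^{Σ(g_i - c_i)} N(c) over increasing c
below the initial part of g, wedged with e at the last entry of g. This is the recursion of A in
disguise, so e_b has coefficient A(b;g) q^{Σ(g_i - b_i)} in N(g) (`nestedWedge_eq_sum_coeffA`).

Next column. A path going from height g to height h picks up weight 1 if h = g and t if h < g, and
disjointness of the paths says g_i < h_{i+1} ≤ g_{i+1}. So the transfer map must send N(g) to the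
weighted sum of N(h) over such interlacing h (`interlaceSum_nestedWedge`). Two facts make this work:
since t + q = 1, the interlacing sum commutes with the damped sum that defines N
(`interlaceSum_comm_dampedSum`), and the boundary terms left in the last factor vanish because they
repeat a factor of the wedge.

New starting point. In the columns meeting the top row, the v_i are iterates, on one vector, of T =
q + tE, where E is the unweighted transfer. When the (k+1)-st path enters, repeated factors kill
every q-part and t^k comes out (`ιMulti_iterate_mul`). The remaining E-images again assemble into
nested wedges (`sum_interlaced_nestedWedge`). The powers of t add up to the binomial exponent. -/

open Classical in
/-- The strictly increasing tuples below `g` in the componentwise order. -/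
noncomputable def strictBelow {p : ℕ} (g : Fin p → ℕ) : Finset (Fin p → ℕ) :=
  (Finset.Iic g).filter StrictMono

/-- The least value that may be appended to a strictly increasing tuple. -/
def nextVal {p : ℕ} (g : Fin p → ℕ) : ℕ :=
  if h : p = 0 then 0 else g ⟨p - 1, by omega⟩ + 1

/-- The tuple with entries `0, g₀ + 1, g₁ + 1, …`. -/
def interlaceLow {p : ℕ} (g : Fin p → ℕ) (i : Fin p) : ℕ :=
  if h : (i : ℕ) = 0 then 0 else g ⟨i - 1, by omega⟩ + 1

/-- The weight of a one-column move from height `a` down to height `b`. -/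
def stepWeight {R : Type*} [CommRing R] (t : R) (a b : ℕ) : R := if a = b then 1 else t

/-! ### Increasing and interlacing tuples -/

section Tuples

variable {p : ℕ}

theorem mem_strictBelow {g c : Fin p → ℕ} : c ∈ strictBelow g ↔ c ≤ g ∧ StrictMono c := by
  simp [strictBelow]

@[simp] theorem nextVal_zero (g : Fin 0 → ℕ) : nextVal g = 0 := by simp [nextVal]

@[simp] theorem nextVal_succ (g : Fin (p + 1) → ℕ) : nextVal g = g (Fin.last p) + 1 := by
  simp [nextVal, Fin.last]

@[simp] theorem interlaceLow_zero (g : Fin (p + 1) → ℕ) : interlaceLow g 0 = 0 := by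
  simp [interlaceLow]

@[simp] theorem interlaceLow_succ (g : Fin (p + 1) → ℕ) (i : Fin p) :
    interlaceLow g i.succ = g i.castSucc + 1 := by
  simp [interlaceLow]
  rfl

theorem interlaceLow_last (g : Fin (p + 1) → ℕ) :
    interlaceLow g (Fin.last p) = nextVal (Fin.init g) := by
  cases p with
  | zero => simp [interlaceLow]
  | succ p => simp [interlaceLow, Fin.init]; rfl

theorem init_interlaceLow (g : Fin (p + 1) → ℕ) :
    Fin.init (interlaceLow g) = interlaceLow (Fin.init g) := by
  funext i
  simp [interlaceLow, Fin.init]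

theorem interlaceLow_le_iff {g l : Fin (p + 1) → ℕ} :
    interlaceLow g ≤ l ↔ ∀ i : Fin p, g i.castSucc < l i.succ := by
  constructor
  · intro h i
    have := h i.succ
    rw [interlaceLow_succ] at this
    exact this
  · intro h i
    refine Fin.cases ?_ (fun j => ?_) i
    · simp
    · rw [interlaceLow_succ]; exact h j

theorem strictMono_iff_interlaceLow_le {g : Fin p → ℕ} : StrictMono g ↔ interlaceLow g ≤ g := by
  cases p with
  | zero => exact ⟨fun _ i => i.elim0, fun _ i => i.elim0⟩
  | succ p => rw [interlaceLow_le_iff, Fin.strictMono_iff_lt_succ]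

theorem interlaceLow_mono {g h : Fin p → ℕ} (H : g ≤ h) : interlaceLow g ≤ interlaceLow h := by
  intro i
  unfold interlaceLow
  split_ifs
  · exact le_rfl
  · exact Nat.succ_le_succ (H _)

theorem nextVal_mono {g h : Fin p → ℕ} (H : g ≤ h) : nextVal g ≤ nextVal h := by
  unfold nextVal
  split_ifs
  · exact le_rfl
  · exact Nat.succ_le_succ (H _)

theorem strictMono_init {g : Fin (p + 1) → ℕ} (hg : StrictMono g) : StrictMono (Fin.init g) :=
  fun _ _ h => hg (Fin.castSucc_lt_castSucc_iff.2 h)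

theorem nextVal_init_le {g : Fin (p + 1) → ℕ} (hg : StrictMono g) :
    nextVal (Fin.init g) ≤ g (Fin.last p) := by
  rw [← interlaceLow_last]
  exact strictMono_iff_interlaceLow_le.1 hg _

theorem le_iff_init_le {a b : Fin (p + 1) → ℕ} :
    a ≤ b ↔ Fin.init a ≤ Fin.init b ∧ a (Fin.last p) ≤ b (Fin.last p) := by
  constructor
  · exact fun h => ⟨fun i => h _, h _⟩
  · rintro ⟨h1, h2⟩ i
    exact Fin.lastCases h2 (fun j => h1 j) i

theorem strictMono_iff_init {g : Fin (p + 1) → ℕ} :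
    StrictMono g ↔ StrictMono (Fin.init g) ∧ nextVal (Fin.init g) ≤ g (Fin.last p) := by
  rw [strictMono_iff_interlaceLow_le, le_iff_init_le, init_interlaceLow, interlaceLow_last,
    ← strictMono_iff_interlaceLow_le]

theorem sum_Icc_snoc {M : Type*} [AddCommMonoid M] (a b : Fin (p + 1) → ℕ)
    (F : (Fin (p + 1) → ℕ) → M) :
    ∑ h ∈ Finset.Icc a b, F h =
      ∑ h' ∈ Finset.Icc (Fin.init a) (Fin.init b),
        ∑ y ∈ Finset.Icc (a (Fin.last p)) (b (Fin.last p)), F (Fin.snoc h' y) := by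
  rw [← Finset.sum_product']
  refine Finset.sum_nbij' (fun h => (Fin.init h, h (Fin.last p))) (fun z => Fin.snoc z.1 z.2)
    ?_ ?_ ?_ ?_ ?_
  · intro h hh
    simp only [Finset.mem_Icc, Finset.mem_product, le_iff_init_le (p := p)] at hh ⊢
    tauto
  · rintro ⟨h', y⟩ hh
    simp only [Finset.mem_Icc, Finset.mem_product, le_iff_init_le (p := p), Fin.init_snoc,
      Fin.snoc_last] at hh ⊢
    tauto
  · intro h _
    exact Fin.snoc_init_self h
  · rintro ⟨h', y⟩ _
    simp
  · intro h _
    simp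

theorem sum_strictBelow_snoc {M : Type*} [AddCommMonoid M] (g : Fin (p + 1) → ℕ)
    (F : (Fin (p + 1) → ℕ) → M) :
    ∑ c ∈ strictBelow g, F c =
      ∑ c' ∈ strictBelow (Fin.init g),
        ∑ y ∈ Finset.Icc (nextVal c') (g (Fin.last p)), F (Fin.snoc c' y) := by
  rw [Finset.sum_sigma']
  refine Finset.sum_nbij' (fun h => ⟨Fin.init h, h (Fin.last p)⟩) (fun z => Fin.snoc z.1 z.2)
    ?_ ?_ ?_ ?_ ?_
  · intro h hh
    simp only [Finset.mem_sigma, Finset.mem_Icc, mem_strictBelow, le_iff_init_le (p := p),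
      strictMono_iff_init (p := p)] at hh ⊢
    tauto
  · rintro ⟨h', y⟩ hh
    simp only [Finset.mem_sigma, Finset.mem_Icc, mem_strictBelow, le_iff_init_le (p := p),
      strictMono_iff_init (p := p), Fin.init_snoc, Fin.snoc_last] at hh ⊢
    tauto
  · intro h _
    exact Fin.snoc_init_self h
  · rintro ⟨h', y⟩ _
    simp
  · intro h _
    simp

end Tuples

/-! ### Commutation of damped and interlacing sums -/

section Kernels

variable {R : Type*} [CommRing R] {M : Type*} [AddCommGroup M] [Module R M] {p : ℕ}

/-- The weighted sum over all strictly increasing tuples below `g`. -/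
noncomputable def dampedSum (q : R) (F : (Fin p → ℕ) → M) (g : Fin p → ℕ) : M :=
  ∑ c ∈ strictBelow g, q ^ (∑ i, (g i - c i)) • F c

/-- The weighted sum over all tuples that interlace with `g` from below. -/
noncomputable def interlaceSum (t : R) (F : (Fin p → ℕ) → M) (g : Fin p → ℕ) : M :=
  ∑ h ∈ Finset.Icc (interlaceLow g) g, (∏ i, stepWeight t (g i) (h i)) • F h

theorem sum_Icc_add_left {M : Type*} [AddCommMonoid M] {a g : ℕ} (hag : a ≤ g) (F : ℕ → M) :
    ∑ h ∈ Finset.Icc a g, F h = F a + ∑ h ∈ Finset.Icc (a + 1) g, F h := by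
  rw [← Finset.insert_Icc_succ_left_eq_Icc hag, Finset.sum_insert (by simp)]
  rfl

/-- Adding the terms from the top down, each step is t q^{a-l} + q^{a+1-l} = q^{a-l}. -/
theorem sum_stepWeight_mul_pow_sub {t q : R} (htq : t + q = 1) {l a g : ℕ} (hla : l ≤ a)
    (hag : a ≤ g) :
    ∑ h ∈ Finset.Icc a g, stepWeight t g h * q ^ (h - l) = q ^ (a - l) := by
  obtain ⟨d, rfl⟩ := Nat.exists_eq_add_of_le hag
  induction d generalizing a with
  | zero => simp [stepWeight]
  | succ d ih =>
    have h1 := ih (a := a + 1) (by omega) (by omega)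
    rw [show a + 1 + d = a + (d + 1) by omega] at h1
    rw [sum_Icc_add_left hag, h1, stepWeight, if_neg (by omega),
      show a + 1 - l = (a - l) + 1 by omega]
    linear_combination q ^ (a - l) * htq

theorem sum_pow_sub_mul_stepWeight {t q : R} (htq : t + q = 1) {l u g : ℕ} (hlu : l ≤ u)
    (hug : u ≤ g) :
    ∑ h ∈ Finset.Icc l u, q ^ (g - h) * stepWeight t h l = q ^ (g - u) := by
  induction u, hlu using Nat.le_induction with
  | base => simp [stepWeight]
  | succ u hlu ih =>
    rw [Finset.sum_Icc_succ_top (by omega), ih (by omega), stepWeight, if_neg (by omega),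
      show g - u = g - (u + 1) + 1 by omega]
    linear_combination q ^ (g - (u + 1)) * htq

theorem Icc_eq_piFinset (a b : Fin p → ℕ) :
    Finset.Icc a b = Fintype.piFinset fun i => Finset.Icc (a i) (b i) := rfl

/-- For fixed l the entries of the middle tuple vary independently in intervals, so the kernel
factorises into one-variable sums. -/
theorem interlaceSum_dampedSum {t q : R} (htq : t + q = 1) (F : (Fin p → ℕ) → M)
    {g : Fin p → ℕ} (hg : StrictMono g) :
    interlaceSum t (dampedSum q F) g =
      ∑ l ∈ strictBelow g, (∏ i, q ^ (interlaceLow g i - l i)) • F l := by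
  have hlow := strictMono_iff_interlaceLow_le.1 hg
  simp only [interlaceSum, dampedSum, Finset.smul_sum, smul_smul]
  rw [Finset.sum_comm' (t' := strictBelow g) (s' := fun l => Finset.Icc (interlaceLow g ⊔ l) g)]
  · refine Finset.sum_congr rfl fun l hl => ?_
    rw [← Finset.sum_smul, Icc_eq_piFinset]
    simp only [← Finset.prod_pow_eq_pow_sum, ← Finset.prod_mul_distrib]
    rw [← Finset.prod_univ_sum (fun i => Finset.Icc ((interlaceLow g ⊔ l) i) (g i))
      (fun i h => stepWeight t (g i) h * q ^ (h - l i))]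
    congr 1
    refine Finset.prod_congr rfl fun i _ => ?_
    rw [sum_stepWeight_mul_pow_sub htq (a := (interlaceLow g ⊔ l) i) (l := l i) (by simp)
      (sup_le (hlow i) ((mem_strictBelow.1 hl).1 i))]
    -- max(low, l) - l is the truncated difference low - l.
    congr 1
    simp only [Pi.sup_apply]
    omega
  · intro h l
    simp only [Finset.mem_Icc, mem_strictBelow, sup_le_iff]
    constructor
    · rintro ⟨⟨h1, h2⟩, h3, h4⟩
      exact ⟨⟨⟨h1, h3⟩, h2⟩, h3.trans h2, h4⟩
    · rintro ⟨⟨⟨h1, h3⟩, h2⟩, -, h4⟩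
      exact ⟨⟨h1, h2⟩, h3, h4⟩

/-- Again the middle tuple fills a box. Its strict monotonicity costs nothing: interlacing gives h_i
< l_{i+1} ≤ h_{i+1}. -/
theorem dampedSum_interlaceSum {t q : R} (htq : t + q = 1) (F : (Fin p → ℕ) → M)
    {g : Fin p → ℕ} :
    dampedSum q (interlaceSum t F) g =
      ∑ l ∈ strictBelow g, (∏ i, q ^ (interlaceLow g i - l i)) • F l := by
  cases p with
  | zero =>
    simp only [interlaceSum, dampedSum]
    refine Finset.sum_congr rfl fun c _ => ?_
    have : Finset.Icc (interlaceLow c) c = {c} := by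
      ext; simp [Subsingleton.elim _ c]
    rw [this]
    simp
  | succ p =>
  simp only [interlaceSum, dampedSum, Finset.smul_sum, smul_smul]
  -- The upper corner of that box: h_i ≤ g_i and h_i < l_{i+1}, with no second bound on the last
  -- entry.
  let up : (Fin (p + 1) → ℕ) → Fin (p + 1) → ℕ := fun l =>
    Fin.snoc (fun i : Fin p => min (g i.castSucc) (l i.succ - 1)) (g (Fin.last p))
  have hup : ∀ l, up l ≤ g := fun l i => by
    refine Fin.lastCases ?_ (fun j => ?_) i <;> simp [up]
  rw [Finset.sum_comm' (t' := strictBelow g) (s' := fun l => Finset.Icc l (up l))]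
  · refine Finset.sum_congr rfl fun l hl => ?_
    obtain ⟨hlg, hl⟩ := mem_strictBelow.1 hl
    have hlt : ∀ i : Fin p, l i.castSucc < l i.succ := fun i => hl i.castSucc_lt_succ
    have hlu : l ≤ up l := fun i => by
      refine Fin.lastCases ?_ (fun j => ?_) i
      · simpa [up] using hlg _
      · have := hlt j
        simp only [up, Fin.snoc_castSucc, le_inf_iff]
        exact ⟨hlg _, by omega⟩
    rw [← Finset.sum_smul, Icc_eq_piFinset]
    simp only [← Finset.prod_pow_eq_pow_sum, ← Finset.prod_mul_distrib]
    rw [← Finset.prod_univ_sum (fun i => Finset.Icc (l i) (up l i))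
      (fun i h => q ^ (g i - h) * stepWeight t h (l i))]
    congr 1
    -- The factor found at index i is the expected one at i + 1. Hence one product sheds its last
    -- factor and the other its first; both are 1.
    rw [Finset.prod_congr rfl fun i _ => sum_pow_sub_mul_stepWeight htq (hlu i) (hup l i),
      Fin.prod_univ_castSucc, Fin.prod_univ_succ]
    simp only [up, Fin.snoc_castSucc, Fin.snoc_last, interlaceLow_zero, interlaceLow_succ,
      Nat.zero_sub, Nat.sub_self, pow_zero, mul_one, one_mul]
    refine Finset.prod_congr rfl fun i _ => ?_
    congr 1
    have := hlt i
    omega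
  · intro h l
    simp only [Finset.mem_Icc, mem_strictBelow, interlaceLow_le_iff]
    constructor
    · rintro ⟨⟨h1, h2⟩, h3, h4⟩
      refine ⟨⟨h4, ?_⟩, h4.trans h1, ?_⟩
      · intro i
        refine Fin.lastCases ?_ (fun j => ?_) i
        · simpa [up] using h1 _
        · have := h3 j
          simp only [up, Fin.snoc_castSucc, le_inf_iff]
          exact ⟨h1 _, by omega⟩
      · rw [Fin.strictMono_iff_lt_succ]
        exact fun i => (h4 _).trans_lt (h3 i)
    · rintro ⟨⟨h1, h2⟩, h3, h4⟩
      have h5 : ∀ i : Fin p, h i.castSucc < l i.succ := fun i => by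
        have h6 := h2 i.castSucc
        simp only [up, Fin.snoc_castSucc, le_inf_iff] at h6
        have := h4 i.castSucc_lt_succ
        omega
      refine ⟨⟨h2.trans (hup l), ?_⟩, h5, h1⟩
      rw [Fin.strictMono_iff_lt_succ]
      exact fun i => (h5 i).trans_le (h1 _)

theorem interlaceSum_comm_dampedSum {t q : R} (htq : t + q = 1) (F : (Fin p → ℕ) → M)
    {g : Fin p → ℕ} (hg : StrictMono g) :
    interlaceSum t (dampedSum q F) g = dampedSum q (interlaceSum t F) g := by
  rw [interlaceSum_dampedSum htq F hg, dampedSum_interlaceSum htq]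

end Kernels

/-! ### Nested wedges and their one-column transfer -/

section Wedge

variable {R : Type*} [CommRing R] {V : Type*} [AddCommGroup V] [Module R V] {p : ℕ}

open ExteriorAlgebra

/-- The iterated wedge product in which each factor `u (g i)` is preceded by a damped sum of the
products of smaller length. -/
noncomputable def nestedWedge (q : R) (u : ℕ → V) : (p : ℕ) → (Fin p → ℕ) → ExteriorAlgebra R V
  | 0, _ => 1
  | p + 1, g => dampedSum q (nestedWedge q u p) (Fin.init g) * ι R (u (g (Fin.last p)))

/-- The partial sums `x 0 + ⋯ + x (g - 1)`. -/
def partialSum (x : ℕ → V) (g : ℕ) : V := ∑ b ∈ Finset.range g, x b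

/-- All the positions reachable from `g` within one column, without weights. -/
def downVec (x : ℕ → V) (g : ℕ) : V := partialSum x (g + 1)

/-- All the positions reachable from `g` within one column, each with its weight. -/
def stepVec (t : R) (x : ℕ → V) (g : ℕ) : V := x g + t • partialSum x g

theorem stepVec_eq {t q : R} (htq : t + q = 1) (x : ℕ → V) (g : ℕ) :
    stepVec t x g = partialSum x (g + 1) - q • partialSum x g := by
  have : t = 1 - q := by rw [← htq]; ring
  rw [stepVec, partialSum, partialSum, Finset.sum_range_succ, this]
  module

/-- Telescopes, since the step vector at c is S(c+1) - q S(c) for the partial sums S. -/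
theorem sum_pow_smul_stepVec {t q : R} (htq : t + q = 1) (x : ℕ → V) {lo g : ℕ}
    (h : lo ≤ g + 1) :
    ∑ c ∈ Finset.Icc lo g, q ^ (g - c) • stepVec t x c =
      partialSum x (g + 1) - q ^ (g + 1 - lo) • partialSum x lo := by
  obtain ⟨d, hd⟩ := Nat.exists_eq_add_of_le h
  induction d generalizing lo with
  | zero =>
    obtain rfl : lo = g + 1 := by omega
    simp
  | succ d ih =>
    rw [sum_Icc_add_left (by omega), ih (by omega) (by omega), stepVec_eq htq,
      show g + 1 - lo = g - lo + 1 by omega, show g + 1 - (lo + 1) = g - lo by omega, pow_succ]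
    module

theorem sum_stepWeight_smul (t : R) (x : ℕ → V) {lo g : ℕ} (h : lo ≤ g) :
    ∑ c ∈ Finset.Icc lo g, stepWeight t g c • x c = stepVec t x g - t • partialSum x lo := by
  obtain ⟨d, hd⟩ := Nat.exists_eq_add_of_le h
  induction d generalizing lo with
  | zero =>
    obtain rfl : g = lo := by omega
    simp [stepWeight, stepVec]
  | succ d ih =>
    rw [sum_Icc_add_left h, ih (by omega) (by omega), stepWeight, if_neg (by omega),
      partialSum, partialSum, Finset.sum_range_succ]
    module

theorem sum_Icc_eq_partialSum_sub (x : ℕ → V) {lo g : ℕ} (h : lo ≤ g + 1) :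
    ∑ c ∈ Finset.Icc lo g, x c = partialSum x (g + 1) - partialSum x lo := by
  rw [partialSum, partialSum, ← Finset.sum_Ico_eq_sub _ h]
  rfl

/-- The last factor of the nested wedge is this very partial sum. All boundary terms are disposed of
in this way. -/
theorem nestedWedge_downVec_mul (q : R) (x : ℕ → V) (g : Fin p → ℕ) :
    nestedWedge q (downVec x) p g * ι R (partialSum x (nextVal g)) = 0 := by
  cases p with
  | zero => simp [partialSum]
  | succ p =>
    rw [nextVal_succ, nestedWedge, mul_assoc, downVec, ι_sq_zero, mul_zero]

/-- By induction the inner damped sum becomes a nested wedge of unweighted vectors; the sum over the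
last entry telescopes and its lower boundary term is annihilated. -/
theorem dampedSum_nestedWedge_stepVec {t q : R} (htq : t + q = 1) (x : ℕ → V)
    {g : Fin p → ℕ} (hg : StrictMono g) :
    dampedSum q (nestedWedge q (stepVec t x) p) g = nestedWedge q (downVec x) p g := by
  induction p with
  | zero =>
    have : strictBelow g = {g} := by
      ext c
      simp [mem_strictBelow, Subsingleton.elim c g, hg]
    simp [dampedSum, nestedWedge, this]
  | succ p ih =>
    rw [dampedSum, sum_strictBelow_snoc]
    simp only [nestedWedge, Fin.init_snoc, Fin.snoc_last, Fin.sum_univ_castSucc, Fin.snoc_castSucc]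
    rw [dampedSum, Finset.sum_mul]
    refine Finset.sum_congr rfl fun c hc => ?_
    obtain ⟨hcg, hc⟩ := mem_strictBelow.1 hc
    rw [ih hc]
    simp only [pow_add, mul_smul]
    rw [← Finset.smul_sum]
    simp only [← mul_smul_comm, ← map_smul]
    rw [← Finset.mul_sum, ← map_sum, sum_pow_smul_stepVec htq, map_sub, map_smul, mul_sub,
      mul_smul_comm, nestedWedge_downVec_mul, smul_zero, sub_zero, smul_mul_assoc]
    · rfl
    · exact ((nextVal_mono hcg).trans (nextVal_init_le hg)).trans (Nat.le_succ _)

/-- The one-column formula is taken as a hypothesis because this statement serves inside the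
induction that proves it. -/
theorem interlaceSum_dampedSum_nestedWedge_aux {t q : R} (htq : t + q = 1) (x : ℕ → V)
    (ih : ∀ g : Fin p → ℕ, StrictMono g →
      interlaceSum t (nestedWedge q x p) g = nestedWedge q (stepVec t x) p g)
    {g : Fin p → ℕ} (hg : StrictMono g) :
    interlaceSum t (dampedSum q (nestedWedge q x p)) g = nestedWedge q (downVec x) p g := by
  rw [interlaceSum_comm_dampedSum htq _ hg, ← dampedSum_nestedWedge_stepVec htq x hg, dampedSum,
    dampedSum]
  exact Finset.sum_congr rfl fun c hc => by rw [ih c (mem_strictBelow.1 hc).2]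

/-- The last entry sums to a step vector minus t S(lo). The other entries, with the sums commuted,
give the unweighted nested wedge, which annihilates S(lo). -/
theorem interlaceSum_nestedWedge {t q : R} (htq : t + q = 1) (x : ℕ → V)
    {g : Fin p → ℕ} (hg : StrictMono g) :
    interlaceSum t (nestedWedge q x p) g = nestedWedge q (stepVec t x) p g := by
  induction p with
  | zero =>
    have : Finset.Icc (interlaceLow g) g = {g} := by
      ext c; simp [Subsingleton.elim c g, Subsingleton.elim (interlaceLow g) g]
    simp [interlaceSum, nestedWedge, this]
  | succ p ih =>
    have hg' := strictMono_init hg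
    rw [interlaceSum, sum_Icc_snoc, init_interlaceLow, interlaceLow_last]
    simp only [nestedWedge, Fin.init_snoc, Fin.snoc_last, Fin.prod_univ_castSucc,
      Fin.snoc_castSucc, mul_smul]
    simp only [← Finset.smul_sum]
    simp only [← mul_smul_comm (stepWeight t _ _), ← map_smul, ← Finset.mul_sum, ← map_sum]
    rw [sum_stepWeight_smul t x (nextVal_init_le hg)]
    simp only [← smul_mul_assoc]
    rw [← Finset.sum_mul]
    refine (congrArg (· * _) (interlaceSum_dampedSum_nestedWedge_aux htq x
      (fun g hg => ih hg) hg')).trans ?_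
    rw [dampedSum_nestedWedge_stepVec htq x hg', map_sub, map_smul, mul_sub, mul_smul_comm,
      nestedWedge_downVec_mul, smul_zero, sub_zero]

theorem interlaceSum_dampedSum_nestedWedge {t q : R} (htq : t + q = 1) (x : ℕ → V)
    {g : Fin p → ℕ} (hg : StrictMono g) :
    interlaceSum t (dampedSum q (nestedWedge q x p)) g = nestedWedge q (downVec x) p g :=
  interlaceSum_dampedSum_nestedWedge_aux htq x (fun _ h => interlaceSum_nestedWedge htq x h) hg

end Wedge

/-! ### Cutting a path at its last column -/

/-- The vertical segment in column `a` between the heights `h` and `g`. -/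
def colSeg (a h g : ℕ) : Finset (ℕ × ℕ) := {a} ×ˢ Finset.Icc h g

/-- The largest height of a point of `C` in column `a`. -/
def colTop (a : ℕ) (C : Finset (ℕ × ℕ)) : ℕ := (C.filter fun p => p.1 = a).sup Prod.snd

/-- The points of `C` in the columns up to `a`. -/
def leftPart (a : ℕ) (C : Finset (ℕ × ℕ)) : Finset (ℕ × ℕ) := C.filter fun p => p.1 ≤ a

theorem mem_colSeg {a h g : ℕ} {p : ℕ × ℕ} : p ∈ colSeg a h g ↔ p.1 = a ∧ h ≤ p.2 ∧ p.2 ≤ g := by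
  simp only [colSeg, Finset.mem_product, Finset.mem_singleton, Finset.mem_Icc]

theorem mem_leftPart {a : ℕ} {C : Finset (ℕ × ℕ)} {p : ℕ × ℕ} :
    p ∈ leftPart a C ↔ p ∈ C ∧ p.1 ≤ a := by
  simp [leftPart]

theorem le_colTop {a y : ℕ} {C : Finset (ℕ × ℕ)} (h : (a, y) ∈ C) : y ≤ colTop a C :=
  Finset.le_sup (f := Prod.snd) (b := (a, y)) (by simp [h])

theorem colTop_mem {a y : ℕ} {C : Finset (ℕ × ℕ)} (h : (a, y) ∈ C) : (a, colTop a C) ∈ C := by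
  have hne : (C.filter fun p => p.1 = a).Nonempty := ⟨(a, y), by simp [h]⟩
  obtain ⟨⟨u, v⟩, hp, he⟩ := Finset.exists_mem_eq_sup _ hne Prod.snd
  rw [Finset.mem_filter] at hp
  obtain ⟨hp, rfl⟩ := hp
  rw [colTop, he]
  exact hp

theorem ptLE_total_iff {C : Set (ℕ × ℕ)} :
    IsChain PtLE C ↔ ∀ p ∈ C, ∀ q ∈ C, PtLE p q ∨ PtLE q p := by
  constructor
  · intro h p hp q hq
    by_cases e : p = q
    · subst e; exact Or.inl ⟨le_rfl, le_rfl⟩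
    · exact h hp hq e
  · exact fun h p hp q hq _ => h p hp q hq

/-- A chain in `Y` with greatest element `P` and least element `Q`. -/
structure IsChainBetween (Y : Finset (ℕ × ℕ)) (P Q : ℕ × ℕ) (C : Finset (ℕ × ℕ)) : Prop where
  subset : C ⊆ Y
  total : ∀ p ∈ C, ∀ q ∈ C, PtLE p q ∨ PtLE q p
  top_mem : P ∈ C
  bot_mem : Q ∈ C
  bot_le : ∀ x ∈ C, PtLE Q x
  le_top : ∀ x ∈ C, PtLE x P

section Path

variable {m n a h g : ℕ} {Y C : Finset (ℕ × ℕ)} {P Q : ℕ × ℕ}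

theorem isPath_iff : IsPath Y P Q C ↔ Maximal (IsChainBetween Y P Q) C := by
  have : (fun D : Finset (ℕ × ℕ) => D ⊆ Y ∧ IsChain PtLE (D : Set (ℕ × ℕ)) ∧ P ∈ D ∧ Q ∈ D ∧
      ∀ x ∈ D, PtLE Q x ∧ PtLE x P) = IsChainBetween Y P Q := by
    funext D
    rw [eq_iff_iff, ptLE_total_iff]
    constructor
    · rintro ⟨h1, h2, h3, h4, h5⟩
      exact ⟨h1, h2, h3, h4, fun x hx => (h5 x hx).1, fun x hx => (h5 x hx).2⟩
    · rintro ⟨h1, h2, h3, h4, h5, h6⟩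
      exact ⟨h1, h2, h3, h4, fun x hx => ⟨h5 x hx, h6 x hx⟩⟩
  rw [IsPath, this]

theorem mem_paths : C ∈ paths Y P Q ↔ IsPath Y P Q C := by
  simp only [paths, Finset.mem_filter, Finset.mem_powerset, and_iff_right_iff_imp]
  exact fun h => h.prop.1

theorem IsPath.chain (hC : IsPath Y P Q C) : IsChainBetween Y P Q C := (isPath_iff.1 hC).prop

/-- Maximality in usable form: inserting such a point would give a larger chain. -/
theorem IsPath.mem_of_comparable (hC : IsPath Y P Q C) {z : ℕ × ℕ} (hz : z ∈ Y)
    (hQ : PtLE Q z) (hP : PtLE z P) (hcomp : ∀ x ∈ C, PtLE z x ∨ PtLE x z) : z ∈ C := by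
  have hc := hC.chain
  refine (isPath_iff.1 hC).le_of_ge (y := insert z C) ?_ (Finset.subset_insert z C)
    (Finset.mem_insert_self z C)
  refine ⟨Finset.insert_subset hz hc.subset, ?_, Finset.mem_insert_of_mem hc.top_mem,
    Finset.mem_insert_of_mem hc.bot_mem, ?_, ?_⟩
  · intro p hp q hq
    rcases Finset.mem_insert.1 hp with rfl | hp' <;> rcases Finset.mem_insert.1 hq with rfl | hq'
    · exact Or.inl ⟨le_rfl, le_rfl⟩
    · exact hcomp q hq'
    · exact (hcomp p hp').symm
    · exact hc.total p hp' q hq'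
  · intro x hx
    rcases Finset.mem_insert.1 hx with rfl | hx
    exacts [hQ, hc.bot_le x hx]
  · intro x hx
    rcases Finset.mem_insert.1 hx with rfl | hx
    exacts [hP, hc.le_top x hx]

theorem IsOneSidedLadder.pos (hY : IsOneSidedLadder m n Y) {p : ℕ × ℕ} (hp : p ∈ Y) :
    1 ≤ p.1 ∧ 1 ≤ p.2 ∧ p.2 ≤ n := by
  have := hY.subset_rect hp
  simp only [Finset.mem_product, Finset.mem_Icc] at this
  tauto

theorem IsPath.colTop_mem (hC : IsPath Y P (a, h) C) : (a, colTop a C) ∈ C :=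
  _root_.colTop_mem hC.chain.bot_mem

theorem IsPath.le_colTop (hC : IsPath Y P (a, h) C) : h ≤ colTop a C :=
  _root_.le_colTop hC.chain.bot_mem

theorem IsPath.colTop_le (hC : IsPath Y P (a, h) C) : colTop a C ≤ P.2 :=
  (hC.chain.le_top _ hC.colTop_mem).2

theorem IsPath.colSeg_subset (hY : IsOneSidedLadder m n Y) (hC : IsPath Y P (a, h) C) :
    colSeg a h (colTop a C) ⊆ C := by
  rintro ⟨u, y⟩ hz
  obtain ⟨rfl, h1, h2⟩ := mem_colSeg.1 hz
  have hc := hC.chain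
  have htop := hC.colTop_mem
  have hb := hY.pos (hc.subset hc.bot_mem)
  have hP := hc.le_top _ htop
  refine hC.mem_of_comparable (hY.closed _ (hc.subset htop) _ hb.1 (hb.2.1.trans h1) le_rfl h2)
    ⟨le_rfl, h1⟩ ⟨hP.1, h2.trans hP.2⟩ ?_
  rintro ⟨s, w⟩ hx
  have hq := hc.bot_le _ hx
  have ht := hc.total _ hx _ htop
  simp only [PtLE] at *
  by_cases e : s = u
  · omega
  · omega

theorem IsPath.eq_union (hY : IsOneSidedLadder m n Y) (hC : IsPath Y P (a + 1, h) C) :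
    leftPart a C ∪ colSeg (a + 1) h (colTop (a + 1) C) = C := by
  ext ⟨u, y⟩
  rw [Finset.mem_union, mem_leftPart, mem_colSeg]
  constructor
  · rintro (⟨h, -⟩ | h)
    · exact h
    · exact hC.colSeg_subset hY (mem_colSeg.2 h)
  · intro hu
    have hq := hC.chain.bot_le _ hu
    by_cases e : u ≤ a
    · exact Or.inl ⟨hu, e⟩
    · obtain rfl : u = a + 1 := by simp only [PtLE] at hq; omega
      exact Or.inr ⟨rfl, hq.2, _root_.le_colTop hu⟩

theorem IsPath.colTop_le_of_mem_leftPart (hC : IsPath Y P (a + 1, h) C) {p : ℕ × ℕ} (hp : p ∈ C)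
    (hpa : p.1 ≤ a) : colTop (a + 1) C ≤ p.2 := by
  have := hC.chain.total _ hp _ hC.colTop_mem
  simp only [PtLE] at this
  omega

/-- A path enters its last column by a horizontal step: the left neighbour of the top point there is
comparable with every point of the path. -/
theorem IsPath.corner_mem (hY : IsOneSidedLadder m n Y) (hP : 1 ≤ P.1) (hPa : P.1 ≤ a)
    (hC : IsPath Y P (a + 1, h) C) : (a, colTop (a + 1) C) ∈ C := by
  have hc := hC.chain
  have htop := hC.colTop_mem
  have hb := hY.pos (hc.subset htop)
  refine hC.mem_of_comparable (hY.closed _ (hc.subset htop) _ (hP.trans hPa) hb.2.1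
    (Nat.le_succ a) le_rfl) ⟨Nat.le_succ a, hC.le_colTop⟩ ⟨hPa, hC.colTop_le⟩ ?_
  rintro ⟨s, w⟩ hx
  have hq := hc.bot_le _ hx
  by_cases e : s ≤ a
  · have := hC.colTop_le_of_mem_leftPart hx e
    simp only [PtLE] at *
    omega
  · obtain rfl : s = a + 1 := by simp only [PtLE] at hq; omega
    exact Or.inr ⟨Nat.le_succ a, _root_.le_colTop hx⟩

theorem IsChainBetween.union_colSeg (hY : IsOneSidedLadder m n Y) (hC : IsChainBetween Y P (a, g) C)
    (hh : 1 ≤ h) (hhg : h ≤ g) (hg : (a + 1, g) ∈ Y) :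
    IsChainBetween Y P (a + 1, h) (C ∪ colSeg (a + 1) h g) := by
  have hPg := hC.le_top _ hC.bot_mem
  refine ⟨?_, ?_, Finset.mem_union_left _ hC.top_mem,
    Finset.mem_union_right _ (mem_colSeg.2 ⟨rfl, le_rfl, hhg⟩), ?_, ?_⟩
  · refine Finset.union_subset hC.subset fun p hp => ?_
    obtain ⟨h1, h2, h3⟩ := mem_colSeg.1 hp
    exact hY.closed _ hg _ (by omega) (hh.trans h2) h1.le h3
  · intro p hp q hq
    rcases Finset.mem_union.1 hp with hp | hp <;> rcases Finset.mem_union.1 hq with hq | hq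
    · exact hC.total p hp q hq
    · have := hC.bot_le _ hp
      rw [mem_colSeg] at hq
      simp only [PtLE] at *
      omega
    · have := hC.bot_le _ hq
      rw [mem_colSeg] at hp
      simp only [PtLE] at *
      omega
    · rw [mem_colSeg] at hp hq
      simp only [PtLE] at *
      omega
  · intro x hx
    rcases Finset.mem_union.1 hx with hx | hx
    · have := hC.bot_le _ hx
      simp only [PtLE] at *
      omega
    · rw [mem_colSeg] at hx
      simp only [PtLE] at *
      omega
  · intro x hx
    rcases Finset.mem_union.1 hx with hx | hx
    · exact hC.le_top _ hx
    · rw [mem_colSeg] at hx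
      simp only [PtLE] at *
      omega

theorem IsChainBetween.leftPart_of_mem (hC : IsChainBetween Y P (a + 1, h) C) (hPa : P.1 ≤ a)
    (h1 : (a, g) ∈ C) (h2 : (a + 1, g) ∈ C) : IsChainBetween Y P (a, g) (leftPart a C) := by
  refine ⟨(Finset.filter_subset _ _).trans hC.subset, ?_, mem_leftPart.2 ⟨hC.top_mem, hPa⟩,
    mem_leftPart.2 ⟨h1, le_rfl⟩, ?_, ?_⟩
  · exact fun p hp q hq => hC.total p (mem_leftPart.1 hp).1 q (mem_leftPart.1 hq).1
  · intro x hx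
    obtain ⟨hx, hxa⟩ := mem_leftPart.1 hx
    have := hC.total _ hx _ h2
    simp only [PtLE] at *
    omega
  · exact fun x hx => hC.le_top x (mem_leftPart.1 hx).1

theorem leftPart_union_colSeg (hC : IsChainBetween Y P (a, g) C) :
    leftPart a (C ∪ colSeg (a + 1) h g) = C := by
  ext p
  rw [mem_leftPart, Finset.mem_union, mem_colSeg]
  constructor
  · rintro ⟨h | h, h'⟩
    · exact h
    · omega
  · exact fun hp => ⟨Or.inl hp, (hC.bot_le _ hp).1⟩

theorem colTop_union_colSeg (hC : IsChainBetween Y P (a, g) C) (hhg : h ≤ g) :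
    colTop (a + 1) (C ∪ colSeg (a + 1) h g) = g := by
  have hg : (a + 1, g) ∈ C ∪ colSeg (a + 1) h g :=
    Finset.mem_union_right _ (mem_colSeg.2 ⟨rfl, hhg, le_rfl⟩)
  refine le_antisymm ?_ (le_colTop hg)
  rcases Finset.mem_union.1 (colTop_mem hg) with h1 | h1
  · have := (hC.bot_le _ h1).1
    simp at this
  · exact (mem_colSeg.1 h1).2.2

/-- A chain larger than the left part would, with the last column attached, be larger than the whole
path. -/
theorem IsPath.leftPart_isPath (hY : IsOneSidedLadder m n Y) (hP : 1 ≤ P.1) (hPa : P.1 ≤ a)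
    (hC : IsPath Y P (a + 1, h) C) : IsPath Y P (a, colTop (a + 1) C) (leftPart a C) := by
  have hcm := hC.corner_mem hY hP hPa
  rw [isPath_iff]
  refine ⟨hC.chain.leftPart_of_mem hPa hcm hC.colTop_mem, fun D hD hle => ?_⟩
  have hh := (hY.pos (hC.chain.subset hC.chain.bot_mem)).2.1
  have h1 := hD.union_colSeg hY hh hC.le_colTop (hC.chain.subset hC.colTop_mem)
  have h2 : C ≤ D ∪ colSeg (a + 1) h (colTop (a + 1) C) := by
    conv_lhs => rw [← hC.eq_union hY]
    exact Finset.union_subset_union_left hle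
  have h3 := (isPath_iff.1 hC).le_of_ge h1 h2
  intro p hp
  exact mem_leftPart.2 ⟨h3 (Finset.mem_union_left _ hp), (hD.bot_le _ hp).1⟩

theorem IsPath.union_colSeg (hY : IsOneSidedLadder m n Y) (hPa : P.1 ≤ a)
    (hC : IsPath Y P (a, g) C) (hh : 1 ≤ h) (hhg : h ≤ g) (hg : (a + 1, g) ∈ Y) :
    IsPath Y P (a + 1, h) (C ∪ colSeg (a + 1) h g) := by
  rw [isPath_iff]
  refine ⟨hC.chain.union_colSeg hY hh hhg hg, fun D hD hle => ?_⟩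
  have hgD : (a + 1, g) ∈ D :=
    hle (Finset.mem_union_right _ (mem_colSeg.2 ⟨rfl, hhg, le_rfl⟩))
  have hgD' : (a, g) ∈ D := hle (Finset.mem_union_left _ hC.chain.bot_mem)
  have h1 := hD.leftPart_of_mem hPa hgD' hgD
  have h2 : leftPart a D ≤ C := (isPath_iff.1 hC).le_of_ge h1 fun p hp =>
    mem_leftPart.2 ⟨hle (Finset.mem_union_left _ hp), (hC.chain.bot_le _ hp).1⟩
  rintro ⟨u, y⟩ hp
  have hq := hD.bot_le _ hp
  by_cases e : u ≤ a
  · exact Finset.mem_union_left _ (h2 (mem_leftPart.2 ⟨hp, e⟩))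
  · refine Finset.mem_union_right _ (mem_colSeg.2 ?_)
    have := hD.total _ hp _ hgD'
    simp only [PtLE] at *
    omega

/-- The only possible new corner is the top of the added segment, entered from the left; it is one
exactly when the segment continues below it. -/
theorem numCorners_union_colSeg (hC : IsChainBetween Y P (a, g) C) (hh : 1 ≤ h) (hhg : h ≤ g) :
    numCorners (C ∪ colSeg (a + 1) h g) = numCorners C + if g = h then 0 else 1 := by
  have hcol : ∀ p ∈ C, p.1 ≤ a ∧ g ≤ p.2 := fun p hp => hC.bot_le p hp
  have hsub : ∀ p ∈ C, ∀ q : ℕ × ℕ, q.1 ≤ p.1 → (q ∈ C ∪ colSeg (a + 1) h g ↔ q ∈ C) := by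
    intro p hp q hq
    have := hcol p hp
    rw [Finset.mem_union, mem_colSeg, or_iff_left_iff_imp]
    omega
  unfold numCorners
  rw [Finset.filter_union, Finset.card_union_of_disjoint]
  · congr 1
    · congr 1
      refine Finset.filter_congr fun p hp => ?_
      rw [hsub p hp _ (by simp), hsub p hp _ (by simp)]
    · have hiff : ∀ p ∈ colSeg (a + 1) h g, ((p.1 - 1, p.2) ∈ C ∪ colSeg (a + 1) h g ∧
          (p.1, p.2 - 1) ∈ C ∪ colSeg (a + 1) h g) ↔ (p = (a + 1, g) ∧ g ≠ h) := by
        rintro ⟨u, y⟩ hp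
        obtain ⟨rfl, h1, h2⟩ := mem_colSeg.1 hp
        simp only [Finset.mem_union, mem_colSeg, Prod.mk.injEq, add_tsub_cancel_right, true_and]
          at *
        constructor
        · rintro ⟨h3 | h3, h4 | h4⟩
          · have := (hcol _ h4).1; simp at this
          · have := (hcol _ h3).2; simp only at this; omega
          · omega
          · omega
        · rintro ⟨rfl, h3⟩
          exact ⟨Or.inl hC.bot_mem, Or.inr (by omega)⟩
      rw [Finset.filter_congr hiff]
      split_ifs with e
      · simp [e]
      · have : (colSeg (a + 1) h g).filter (fun p => p = (a + 1, g) ∧ g ≠ h) = {(a + 1, g)} := by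
          ext p
          simp only [Finset.mem_filter, mem_colSeg, Finset.mem_singleton]
          constructor
          · exact fun hp => hp.2.1
          · rintro rfl
            exact ⟨⟨rfl, hhg, le_rfl⟩, rfl, e⟩
        rw [this, Finset.card_singleton]
  · refine Finset.disjoint_filter_filter ?_
    rw [Finset.disjoint_left]
    intro p hp hp'
    have := (hcol p hp).1
    have := (mem_colSeg.1 hp').1
    omega

theorem X_pow_numCorners_union_colSeg (hC : IsChainBetween Y P (a, g) C) (hh : 1 ≤ h)
    (hhg : h ≤ g) : (X : ℤ[X]) ^ numCorners (C ∪ colSeg (a + 1) h g) =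
      stepWeight X g h * X ^ numCorners C := by
  rw [numCorners_union_colSeg hC hh hhg, stepWeight]
  split_ifs
  · simp
  · rw [pow_succ]; ring

/-- Classify paths by the height g at which they enter the last column. -/
theorem pathPoly_succ (hY : IsOneSidedLadder m n Y) (hP : 1 ≤ P.1) (hPn : P.2 ≤ n)
    (hPa : P.1 ≤ a) (hh : 1 ≤ h) :
    pathPoly Y P (a + 1, h) = ∑ g ∈ (Finset.Icc h n).filter (fun g => (a + 1, g) ∈ Y),
      stepWeight X g h * pathPoly Y P (a, g) := by
  simp only [pathPoly, Finset.mul_sum]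
  rw [Finset.sum_sigma']
  refine Finset.sum_nbij' (fun C => ⟨colTop (a + 1) C, leftPart a C⟩)
    (fun z => z.2 ∪ colSeg (a + 1) h z.1) ?_ ?_ ?_ ?_ ?_
  · intro C hC
    rw [mem_paths] at hC
    simp only [Finset.mem_sigma, Finset.mem_filter, Finset.mem_Icc, mem_paths]
    exact ⟨⟨⟨hC.le_colTop, hC.colTop_le.trans hPn⟩, hC.chain.subset hC.colTop_mem⟩,
      hC.leftPart_isPath hY hP hPa⟩
  · rintro ⟨g, C⟩ hC
    simp only [Finset.mem_sigma, Finset.mem_filter, Finset.mem_Icc, mem_paths] at hC ⊢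
    exact hC.2.union_colSeg hY hPa hh hC.1.1.1 hC.1.2
  · intro C hC
    exact (mem_paths.1 hC).eq_union hY
  · rintro ⟨g, C⟩ hC
    simp only [Finset.mem_sigma, Finset.mem_filter, Finset.mem_Icc, mem_paths] at hC ⊢
    rw [colTop_union_colSeg hC.2.chain hC.1.1.1, leftPart_union_colSeg hC.2.chain]
  · intro C hC
    have hC := mem_paths.1 hC
    conv_lhs => rw [← hC.eq_union hY]
    exact X_pow_numCorners_union_colSeg (hC.leftPart_isPath hY hP hPa).chain
      (hY.pos (hC.chain.subset hC.chain.bot_mem)).2.1 hC.le_colTop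

theorem isPath_vertical_iff (hY : IsOneSidedLadder m n Y) {i : ℕ} (hi : (i, n) ∈ Y) (hh : 1 ≤ h)
    (hhn : h ≤ n) : IsPath Y (i, n) (i, h) C ↔ C = colSeg i h n := by
  have key : ∀ D, IsChainBetween Y (i, n) (i, h) D → D ⊆ colSeg i h n := by
    rintro D hD ⟨u, y⟩ hp
    have h1 := hD.bot_le _ hp
    have h2 := hD.le_top _ hp
    rw [mem_colSeg]
    simp only [PtLE] at *
    omega
  have hseg : IsChainBetween Y (i, n) (i, h) (colSeg i h n) := by
    refine ⟨fun p hp => ?_, ?_, mem_colSeg.2 ⟨rfl, hhn, le_rfl⟩, mem_colSeg.2 ⟨rfl, le_rfl, hhn⟩,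
      ?_, ?_⟩
    · obtain ⟨h1, h2, h3⟩ := mem_colSeg.1 hp
      exact hY.closed _ hi _ (h1 ▸ (hY.pos hi).1) (hh.trans h2) h1.le h3
    all_goals simp only [mem_colSeg, PtLE]
    all_goals omega
  rw [isPath_iff]
  constructor
  · exact fun hC => le_antisymm (key C hC.prop) (hC.le_of_ge hseg (key C hC.prop))
  · rintro rfl
    exact ⟨hseg, fun D hD _ => key D hD⟩

theorem numCorners_colSeg {i : ℕ} (hi : 1 ≤ i) : numCorners (colSeg i h g) = 0 := by
  rw [numCorners, Finset.card_eq_zero, Finset.filter_eq_empty_iff]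
  intro p hp
  rw [mem_colSeg] at *
  simp only [mem_colSeg]
  omega

theorem pathPoly_vertical (hY : IsOneSidedLadder m n Y) {i : ℕ} (hi : (i, n) ∈ Y) (hh : 1 ≤ h)
    (hhn : h ≤ n) : pathPoly Y (i, n) (i, h) = 1 := by
  have : paths Y (i, n) (i, h) = {colSeg i h n} := by
    ext C
    rw [mem_paths, isPath_vertical_iff hY hi hh hhn, Finset.mem_singleton]
  rw [pathPoly, this, Finset.sum_singleton, numCorners_colSeg (hY.pos hi).1, pow_zero]

end Path

/-! ### Cutting a disjoint family at its last column -/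

section Family

variable {m n a k : ℕ} {Y : Finset (ℕ × ℕ)} {P : Fin k → ℕ × ℕ} {h : Fin k → ℕ}
  {C : Fin k → Finset (ℕ × ℕ)}

theorem mem_nonIntersecting {Q : Fin k → ℕ × ℕ} : C ∈ nonIntersecting Y P Q ↔
    (∀ i, IsPath Y (P i) (Q i) (C i)) ∧ ∀ i j, i ≠ j → Disjoint (C i) (C j) := by
  simp [nonIntersecting, Fintype.mem_piFinset, mem_paths]

theorem lt_of_interlaceLow_le {g : Fin k → ℕ} (hh : StrictMono h) (H : interlaceLow g ≤ h)
    {i j : Fin k} (hij : i < j) : g i < h j := by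
  have hlt : (i : ℕ) + 1 < k := lt_of_le_of_lt (Nat.succ_le_of_lt hij) j.2
  have h1 := H ⟨i + 1, hlt⟩
  simp only [interlaceLow, Nat.add_eq_zero_iff, one_ne_zero, and_false, dite_false,
    Nat.add_sub_cancel] at h1
  have h2 : h ⟨i + 1, hlt⟩ ≤ h j := hh.monotone (Nat.succ_le_of_lt hij)
  exact lt_of_lt_of_le h1 h2

theorem interlaceLow_le_of_lt {g : Fin k → ℕ} (H : ∀ i j, i < j → g i < h j) :
    interlaceLow g ≤ h := by
  intro j
  unfold interlaceLow
  split_ifs with h0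
  · exact Nat.zero_le _
  · exact H _ _ (Fin.lt_def.2 (by simp only; omega))

/-- Otherwise the vertical part of the lower path would run through the end point of the higher one.
-/
theorem colTop_lt_of_nonIntersecting (hY : IsOneSidedLadder m n Y) (hh : StrictMono h)
    (hC : C ∈ nonIntersecting Y P (endPt a h)) {i j : Fin k} (hij : i < j) :
    colTop a (C i) < h j := by
  rw [mem_nonIntersecting] at hC
  by_contra hcon
  rw [not_lt] at hcon
  have h1 : (a, h j) ∈ C i :=
    (hC.1 i).colSeg_subset hY (mem_colSeg.2 ⟨rfl, (hh hij).le, hcon⟩)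
  exact Finset.disjoint_left.1 (hC.2 i j hij.ne) h1 (hC.1 j).chain.bot_mem

/-- The test function Φ of the entry heights lets the same bijection serve when a further path below
starts to constrain those heights; Φ = 1 gives the plain recursion. -/
theorem sum_nonIntersecting_succ (hY : IsOneSidedLadder m n Y) (hP : ∀ i, 1 ≤ (P i).1)
    (hPn : ∀ i, (P i).2 ≤ n) (hPa : ∀ i, (P i).1 ≤ a) (hh1 : ∀ i, 1 ≤ h i) (hh : StrictMono h)
    (Φ : (Fin k → ℕ) → ℤ[X]) :
    ∑ C ∈ nonIntersecting Y P (endPt (a + 1) h),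
        Φ (fun i => colTop (a + 1) (C i)) * X ^ (∑ i, numCorners (C i)) =
      ∑ g ∈ (strictBelow fun _ : Fin k => n).filter
          (fun g => (∀ i, (a + 1, g i) ∈ Y) ∧ h ∈ Finset.Icc (interlaceLow g) g),
        Φ g * ((∏ i, stepWeight X (g i) (h i)) * familyPoly Y P (endPt a g)) := by
  simp only [familyPoly, Finset.mul_sum]
  rw [Finset.sum_sigma']
  refine Finset.sum_nbij' (fun C => ⟨fun i => colTop (a + 1) (C i), fun i => leftPart a (C i)⟩)
    (fun z i => z.2 i ∪ colSeg (a + 1) (h i) (z.1 i)) ?_ ?_ ?_ ?_ ?_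
  · intro C hC
    have hlt := fun i j hij => colTop_lt_of_nonIntersecting hY hh hC (i := i) (j := j) hij
    rw [mem_nonIntersecting] at hC
    simp only [Finset.mem_sigma, Finset.mem_filter, Finset.mem_Icc, mem_strictBelow,
      mem_nonIntersecting]
    refine ⟨⟨⟨fun i => (hC.1 i).colTop_le.trans (hPn i), fun i j hij =>
      (hlt i j hij).trans_le (hC.1 j).le_colTop⟩, fun i => (hC.1 i).chain.subset
      (hC.1 i).colTop_mem, interlaceLow_le_of_lt hlt, fun i => (hC.1 i).le_colTop⟩, fun i =>
      (hC.1 i).leftPart_isPath hY (hP i) (hPa i), fun i j hij => ?_⟩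
    exact Finset.disjoint_filter_filter (hC.2 i j hij)
  · rintro ⟨g, C⟩ hz
    simp only [Finset.mem_sigma, Finset.mem_filter, Finset.mem_Icc, mem_strictBelow,
      mem_nonIntersecting] at hz ⊢
    obtain ⟨⟨-, hgY, hlow, hle⟩, hC, hdisj⟩ := hz
    refine ⟨fun i => (hC i).union_colSeg hY (hPa i) (hh1 i) (hle i) (hgY i), ?_⟩
    have hcol : ∀ i j, i < j → g i < h j := fun i j hij => lt_of_interlaceLow_le hh hlow hij
    have haux : ∀ i j, Disjoint (C i) (colSeg (a + 1) (h j) (g j)) := by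
      intro i j
      rw [Finset.disjoint_left]
      intro p hp hp'
      have h1 := ((hC i).chain.bot_le p hp).1
      have h2 := (mem_colSeg.1 hp').1
      simp only [endPt] at h1
      omega
    intro i j hij
    rw [Finset.disjoint_union_left, Finset.disjoint_union_right, Finset.disjoint_union_right]
    refine ⟨⟨hdisj i j hij, haux i j⟩, (haux j i).symm, ?_⟩
    rw [Finset.disjoint_left]
    intro p hp hp'
    rw [mem_colSeg] at hp hp'
    rcases lt_or_gt_of_ne hij with hij | hij
    · have := hcol i j hij; omega
    · have := hcol j i hij; omega
  · intro C hC
    funext i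
    exact ((mem_nonIntersecting.1 hC).1 i).eq_union hY
  · rintro ⟨g, C⟩ hz
    simp only [Finset.mem_sigma, Finset.mem_filter, Finset.mem_Icc, mem_strictBelow,
      mem_nonIntersecting] at hz
    obtain ⟨⟨-, -, -, hle⟩, hC, -⟩ := hz
    have h1 : (fun i => colTop (a + 1) (C i ∪ colSeg (a + 1) (h i) (g i))) = g :=
      funext fun i => colTop_union_colSeg (hC i).chain (hle i)
    have h2 : (fun i => leftPart a (C i ∪ colSeg (a + 1) (h i) (g i))) = C :=
      funext fun i => leftPart_union_colSeg (hC i).chain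
    simp only [h1, h2]
  · intro C hC
    rw [mem_nonIntersecting] at hC
    simp only
    congr 1
    rw [← Finset.prod_pow_eq_pow_sum, ← Finset.prod_pow_eq_pow_sum, ← Finset.prod_mul_distrib]
    refine Finset.prod_congr rfl fun i _ => ?_
    conv_lhs => rw [← (hC.1 i).eq_union hY]
    exact X_pow_numCorners_union_colSeg ((hC.1 i).leftPart_isPath hY (hP i) (hPa i)).chain
      (hh1 i) (hC.1 i).le_colTop

theorem familyPoly_succ (hY : IsOneSidedLadder m n Y) (hP : ∀ i, 1 ≤ (P i).1)
    (hPn : ∀ i, (P i).2 ≤ n) (hPa : ∀ i, (P i).1 ≤ a) (hh1 : ∀ i, 1 ≤ h i) (hh : StrictMono h) :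
    familyPoly Y P (endPt (a + 1) h) =
      ∑ g ∈ (strictBelow fun _ : Fin k => n).filter
          (fun g => (∀ i, (a + 1, g i) ∈ Y) ∧ h ∈ Finset.Icc (interlaceLow g) g),
        (∏ i, stepWeight X (g i) (h i)) * familyPoly Y P (endPt a g) := by
  simpa [familyPoly] using sum_nonIntersecting_succ hY hP hPn hPa hh1 hh (fun _ => 1)

theorem familyPoly_eq_zero {Q : Fin k → ℕ × ℕ} {i : Fin k} (hQ : Q i ∉ Y) :
    familyPoly Y P Q = 0 := by
  rw [familyPoly, Finset.sum_eq_zero]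
  intro C hC
  have := ((mem_nonIntersecting.1 hC).1 i).chain
  exact absurd (this.subset this.bot_mem) hQ

end Family

/-! ### Adding a path at a new starting point -/

section Growth

theorem lt_nextVal {p : ℕ} {g : Fin p → ℕ} (hg : StrictMono g) (i : Fin p) : g i < nextVal g := by
  cases p with
  | zero => exact i.elim0
  | succ p =>
    rw [nextVal_succ]
    exact Nat.lt_succ_of_le (hg.monotone (Fin.le_last i))

variable {m n k : ℕ} {Y : Finset (ℕ × ℕ)}

/-- The new path is a cornerless vertical segment, and it misses the others exactly when its bottom
lies above all their entry heights. -/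
theorem familyPoly_startPt_succ (hY : IsOneSidedLadder m n Y) (hk : (k + 1, n) ∈ Y)
    {h : Fin (k + 1) → ℕ} (hh : StrictMono h) (hh1 : ∀ i, 1 ≤ h i) (hhn : h (Fin.last k) ≤ n) :
    familyPoly Y (startPt n (k + 1)) (endPt (k + 1) h) =
      ∑ g ∈ (strictBelow fun _ : Fin k => n).filter
          (fun g => (∀ i, (k + 1, g i) ∈ Y) ∧ Fin.init h ∈ Finset.Icc (interlaceLow g) g),
        (if nextVal g ≤ h (Fin.last k) then 1 else 0) *
          ((∏ i, stepWeight X (g i) (Fin.init h i)) * familyPoly Y (startPt n k) (endPt k g)) := by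
  have hh' : StrictMono (Fin.init h) := strictMono_init hh
  rw [← sum_nonIntersecting_succ hY (P := startPt n k) (h := Fin.init h) (by simp [startPt])
    (by simp [startPt]) (fun i => i.2) (fun i => hh1 _) hh']
  simp only [ite_mul, one_mul, zero_mul]
  rw [← Finset.sum_filter, familyPoly]
  refine Finset.sum_nbij' (fun C => Fin.init C)
    (fun C => Fin.snoc (α := fun _ => Finset (ℕ × ℕ)) C (colSeg (k + 1) (h (Fin.last k)) n))
    ?_ ?_ ?_ ?_ ?_
  · intro C hC
    have hlt := fun i j hij => colTop_lt_of_nonIntersecting hY hh hC (i := i) (j := j) hij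
    rw [mem_nonIntersecting] at hC
    rw [Finset.mem_filter, mem_nonIntersecting]
    refine ⟨⟨fun i => hC.1 i.castSucc, fun i j hij => hC.2 _ _ (by simpa using hij)⟩, ?_⟩
    cases k with
    | zero => simp
    | succ k =>
      rw [nextVal_succ]
      exact hlt _ _ (Fin.castSucc_lt_last _)
  · intro C hC
    rw [Finset.mem_filter] at hC
    obtain ⟨hC, hnext⟩ := hC
    have hlt := fun i j hij => colTop_lt_of_nonIntersecting hY hh' hC (i := i) (j := j) hij
    rw [mem_nonIntersecting] at hC
    have hmono : StrictMono fun i => colTop (k + 1) (C i) := fun i j hij =>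
      (hlt i j hij).trans_le (hC.1 j).le_colTop
    have hd : ∀ i, Disjoint (C i) (colSeg (k + 1) (h (Fin.last k)) n) := by
      intro i
      rw [Finset.disjoint_left]
      rintro ⟨u, y⟩ hp hp'
      obtain ⟨rfl, h1, -⟩ := mem_colSeg.1 hp'
      have h2 := le_colTop hp
      have h3 := lt_nextVal hmono i
      simp only at *
      omega
    rw [mem_nonIntersecting]
    constructor
    · intro i
      refine Fin.lastCases ?_ (fun j => ?_) i
      · rw [Fin.snoc_last]
        exact (isPath_vertical_iff hY hk (hh1 _) hhn).2 rfl
      · rw [Fin.snoc_castSucc]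
        exact hC.1 j
    · intro i j
      refine Fin.lastCases ?_ (fun i => ?_) i <;> refine Fin.lastCases ?_ (fun j => ?_) j
      · simp
      · intro _
        rw [Fin.snoc_last, Fin.snoc_castSucc]
        exact (hd j).symm
      · intro _
        rw [Fin.snoc_last, Fin.snoc_castSucc]
        exact hd i
      · intro hij
        rw [Fin.snoc_castSucc, Fin.snoc_castSucc]
        exact hC.2 i j (by simpa using hij)
  · intro C hC
    rw [mem_nonIntersecting] at hC
    have : C (Fin.last k) = colSeg (k + 1) (h (Fin.last k)) n :=
      (isPath_vertical_iff hY hk (hh1 _) hhn).1 (hC.1 (Fin.last k))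
    rw [← this]
    exact Fin.snoc_init_self C
  · intro C _
    simp
  · intro C hC
    rw [mem_nonIntersecting] at hC
    have : C (Fin.last k) = colSeg (k + 1) (h (Fin.last k)) n :=
      (isPath_vertical_iff hY hk (hh1 _) hhn).1 (hC.1 (Fin.last k))
    rw [Fin.sum_univ_castSucc, this, numCorners_colSeg (by omega)]
    rfl

end Growth

/-! ### Linear maps acting on wedges -/

section WedgeMaps

open ExteriorAlgebra

variable {R : Type*} [CommRing R] {V : Type*} [AddCommGroup V] [Module R V] {p : ℕ}

theorem ιMulti_succ_last (v : Fin (p + 1) → V) :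
    ιMulti R (p + 1) v = ιMulti R p (fun i => v i.castSucc) * ι R (v (Fin.last p)) := by
  rw [ιMulti_apply, ιMulti_apply, List.ofFn_succ', List.concat_eq_append, List.prod_append]
  simp

theorem map_nestedWedge (L : V →ₗ[R] V) (q : R) (u : ℕ → V) (g : Fin p → ℕ) :
    ExteriorAlgebra.map L (nestedWedge q u p g) = nestedWedge q (fun h => L (u h)) p g := by
  induction p with
  | zero => simp [nestedWedge]
  | succ p ih => simp [nestedWedge, dampedSum, ih]

theorem nestedWedge_congr (q : R) {u u' : ℕ → V} {g : Fin p → ℕ}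
    (H : ∀ i, ∀ h ≤ g i, u h = u' h) : nestedWedge q u p g = nestedWedge q u' p g := by
  induction p with
  | zero => rfl
  | succ p ih =>
    rw [nestedWedge, nestedWedge, H _ _ le_rfl]
    congr 1
    refine Finset.sum_congr rfl fun c hc => ?_
    rw [ih fun i h hi => H i.castSucc h (hi.trans ((mem_strictBelow.1 hc).1 i))]

theorem nestedWedge_eq_zero (q : R) {u : ℕ → V} (hu : u 0 = 0) {g : Fin p → ℕ} {i : Fin p}
    (hi : g i = 0) : nestedWedge q u p g = 0 := by
  induction p with
  | zero => exact i.elim0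
  | succ p ih =>
    rw [nestedWedge]
    revert hi
    refine Fin.lastCases (fun hi => ?_) (fun j hi => ?_) i
    · rw [hi, hu, map_zero, mul_zero]
    · rw [dampedSum, Finset.sum_eq_zero, zero_mul]
      intro c hc
      have : c j ≤ g j.castSucc := (mem_strictBelow.1 hc).1 j
      rw [ih (i := j) (by omega), smul_zero]

/-- In T(f a) = q f(a) + t E(f a) the q-part repeats the next factor of the wedge. So the factors
can be replaced one at a time, each yielding a t. -/
theorem ιMulti_iterate_mul {t q : R} {T E : V →ₗ[R] V} (hT : ∀ v, T v = q • v + t • E v)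
    {f : ℕ → V} (hf : ∀ j, f (j + 1) = T (f j)) (a : ℕ) :
    ιMulti R a (fun i => T (f (a - 1 - i))) * ι R (f 0) =
      t ^ a • (ιMulti R a (fun i => E (f (a - 1 - i))) * ι R (f 0)) := by
  have hstep : ∀ (L : V →ₗ[R] V) (a : ℕ), ιMulti R (a + 1) (fun i => L (f (a + 1 - 1 - i))) =
      ι R (L (f a)) * ιMulti R a (fun i => L (f (a - 1 - i))) := by
    intro L a
    rw [ιMulti_apply, ιMulti_apply, List.ofFn_succ, List.prod_cons]
    congr 4
    funext i
    simp only [Fin.val_succ]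
    congr 3
    omega
  -- The repeated factor is T(f (a - 1)) = f a when a > 0, and the trailing f 0 when a = 0.
  have hzero : ∀ a, ι R (f a) * (ιMulti R a (fun i => T (f (a - 1 - i))) * ι R (f 0)) = 0 := by
    intro a
    cases a with
    | zero => simp [ιMulti_apply]
    | succ a =>
      rw [hstep, hf, ← mul_assoc, ← mul_assoc, ι_sq_zero, zero_mul, zero_mul]
  induction a with
  | zero => simp [ιMulti_apply]
  | succ a ih =>
    rw [hstep, hstep, hT (f a), map_add, map_smul, map_smul, mul_assoc, add_mul, smul_mul_assoc,
      hzero, smul_zero, zero_add, ih, smul_mul_assoc, mul_smul_comm, smul_smul, pow_succ',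
      mul_assoc]

end WedgeMaps

/-! ### Coefficients of nested wedges -/

section Coefficients

/-- One recursion from length 0 on, so that no special cases for short tuples arise later. -/
theorem coeffA_succ (l : ℕ) (b c : Fin (l + 1) → ℕ) :
    coeffA (l + 1) b c = if b (Fin.last l) = c (Fin.last l) then
      ∑ c' ∈ strictBelow (Fin.init c), coeffA l (Fin.init b) c' else 0 := by
  match l, b, c with
  | 0, b, c =>
    have : strictBelow (Fin.init c) = {Fin.init c} := by
      ext d
      simp [mem_strictBelow, Subsingleton.elim d (Fin.init c), Subsingleton.strictMono]
    simp [coeffA, this]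
  | 1, b, c =>
    have hone : ∀ d : Fin 1 → ℕ, d = fun _ => d 0 := fun d => by
      funext i; rw [Subsingleton.elim i 0]
    have h1 : ∀ c' : Fin 1 → ℕ, coeffA 1 (Fin.init b) c' = if Fin.init b = c' then 1 else 0 := by
      intro c'
      rw [coeffA]
      congr 1
      rw [eq_iff_iff]
      constructor
      · intro h
        rw [hone (Fin.init b), hone c', h]
      · intro h; rw [h]
    simp only [h1, Finset.sum_ite_eq]
    have h2 : Fin.init b ∈ strictBelow (Fin.init c) ↔ b 0 ≤ c 0 := by
      rw [mem_strictBelow]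
      constructor
      · exact fun h => h.1 0
      · refine fun h => ⟨fun i => ?_, Subsingleton.strictMono _⟩
        rw [Subsingleton.elim i 0]
        exact h
    simp only [h2, coeffA]
    rw [ite_and]
    rfl
  | l + 2, b, c =>
    rw [coeffA]
    congr 1
    refine Finset.sum_congr ?_ fun _ _ => rfl
    ext d
    rw [mem_strictBelow]
    exact (@Finset.mem_filter _ _ (_) _ _).trans (and_congr_left' Finset.mem_Iic)

theorem coeffA_self (l : ℕ) {b : Fin l → ℕ} (hb : StrictMono b) : coeffA l b b = 1 := by
  induction l with
  | zero => rfl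
  | succ l ih =>
    rw [coeffA_succ, if_pos rfl, Finset.sum_eq_single (Fin.init b), ih (strictMono_init hb)]
    · intro c hc hne
      by_contra h
      exact hne (le_antisymm (mem_strictBelow.1 hc).1 (le_of_coeffA_ne_zero _ _ _ h))
    · intro h
      exact absurd (mem_strictBelow.2 ⟨le_rfl, strictMono_init hb⟩) h

open ExteriorAlgebra

variable {R : Type*} [CommRing R] {V : Type*} [AddCommGroup V] [Module R V] {p : ℕ}

/-- Unfolding the outermost damped sum reproduces the recursion of A; the last entry is fixed by the
last wedge factor. -/
theorem nestedWedge_eq_sum_coeffA (q : R) (x : ℕ → V) {g : Fin p → ℕ} (hg : StrictMono g) :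
    nestedWedge q x p g = ∑ h ∈ strictBelow g,
      ((coeffA p h g : R) * q ^ (∑ i, (g i - h i))) • ιMulti R p (fun i => x (h i)) := by
  induction p with
  | zero =>
    have : strictBelow g = {g} := by
      ext c
      simp [mem_strictBelow, Subsingleton.elim c g, hg]
    simp [nestedWedge, this, coeffA]
  | succ p ih =>
    rw [sum_strictBelow_snoc, nestedWedge, dampedSum]
    have hinner : ∀ h' ∈ strictBelow (Fin.init g),
        ∑ y ∈ Finset.Icc (nextVal h') (g (Fin.last p)),
          ((coeffA (p + 1) (Fin.snoc h' y) g : R) *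
            q ^ (∑ i, (g i - (Fin.snoc h' y : Fin (p + 1) → ℕ) i))) •
              ιMulti R (p + 1) (fun i => x ((Fin.snoc h' y : Fin (p + 1) → ℕ) i)) =
        ∑ c ∈ strictBelow (Fin.init g),
          ((coeffA p h' c : R) * q ^ (∑ i, (Fin.init g i - h' i))) •
            (ιMulti R p (fun i => x (h' i)) * ι R (x (g (Fin.last p)))) := by
      intro h' hh'
      have hle := (nextVal_mono (mem_strictBelow.1 hh').1).trans (nextVal_init_le hg)
      rw [Finset.sum_eq_single (g (Fin.last p))]
      · rw [coeffA_succ, ιMulti_succ_last, Fin.sum_univ_castSucc]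
        simp only [Fin.snoc_last, Fin.snoc_castSucc, Fin.init_snoc, if_true, Nat.sub_self, add_zero]
        rw [← Finset.sum_smul, ← Finset.sum_mul, Nat.cast_sum]
        rfl
      · intro y _ hy
        rw [coeffA_succ, Fin.snoc_last, if_neg hy]
        simp
      · intro h
        exact absurd (Finset.mem_Icc.2 ⟨hle, le_rfl⟩) h
    rw [Finset.sum_congr rfl hinner, Finset.sum_comm, Finset.sum_mul]
    refine Finset.sum_congr rfl fun c hc => ?_
    obtain ⟨hcg, hc⟩ := mem_strictBelow.1 hc
    rw [ih hc, Finset.smul_sum, Finset.sum_mul]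
    -- Enlarging the range of h is harmless, as A(h;c) = 0 unless h ≤ c; for h ≤ c the exponents of
    -- q add up along h ≤ c ≤ g.
    rw [← Finset.sum_subset (s₁ := strictBelow c) (s₂ := strictBelow (Fin.init g))]
    · refine Finset.sum_congr rfl fun h hh => ?_
      have hhc := (mem_strictBelow.1 hh).1
      have : ∑ i, (Fin.init g i - h i) = ∑ i, (Fin.init g i - c i) + ∑ i, (c i - h i) := by
        rw [← Finset.sum_add_distrib]
        refine Finset.sum_congr rfl fun i _ => ?_
        have h1 : c i ≤ Fin.init g i := hcg i
        have h2 : h i ≤ c i := hhc i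
        omega
      rw [this, pow_add, smul_smul, smul_mul_assoc]
      congr 1
      ring
    · intro h hh
      rw [mem_strictBelow] at hh ⊢
      exact ⟨hh.1.trans hcg, hh.2⟩
    · intro h hh hh'
      have : coeffA p h c = 0 := by
        by_contra h0
        exact hh' (mem_strictBelow.2 ⟨le_of_coeffA_ne_zero _ _ _ h0, (mem_strictBelow.1 hh).2⟩)
      simp [this]

end Coefficients

/-! ### The wedge expansion, column by column -/

section Transfer

open ExteriorAlgebra

variable {m n r k a : ℕ} {Y : Finset (ℕ × ℕ)}

/-- The basis vector of height `h`; there is none of height `0`. -/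
noncomputable def heightVec (h : ℕ) : ℕ →₀ ℤ[X] := if h = 0 then 0 else Finsupp.single h 1

/-- The generating vector of the paths from `(i + 1, n)` to column `a`. -/
noncomputable def pathVec (Y : Finset (ℕ × ℕ)) (n a i : ℕ) : ℕ →₀ ℤ[X] :=
  ∑ h ∈ Finset.Icc 1 n, pathPoly Y (i + 1, n) (a, h) • heightVec h

open Classical in
/-- The transfer from column `a` to column `a + 1`. -/
noncomputable def colMap (Y : Finset (ℕ × ℕ)) (a : ℕ) : (ℕ →₀ ℤ[X]) →ₗ[ℤ[X]] (ℕ →₀ ℤ[X]) :=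
  Finsupp.linearCombination ℤ[X] fun h =>
    if (a + 1, h) ∈ Y then stepVec (X : ℤ[X]) heightVec h else 0

/-- The unweighted transfer between columns of unrestricted height. -/
noncomputable def downMap : (ℕ →₀ ℤ[X]) →ₗ[ℤ[X]] (ℕ →₀ ℤ[X]) :=
  Finsupp.linearCombination ℤ[X] (downVec heightVec)

/-- The transfer between columns of unrestricted height. -/
noncomputable def stepMap : (ℕ →₀ ℤ[X]) →ₗ[ℤ[X]] (ℕ →₀ ℤ[X]) :=
  (1 - X : ℤ[X]) • LinearMap.id + (X : ℤ[X]) • downMap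

@[simp] theorem heightVec_zero : heightVec 0 = 0 := by simp [heightVec]

theorem linearCombination_heightVec {f : ℕ → ℕ →₀ ℤ[X]} (hf : f 0 = 0) (h : ℕ) :
    Finsupp.linearCombination ℤ[X] f (heightVec h) = f h := by
  by_cases h0 : h = 0
  · simp [h0, hf]
  · simp [heightVec, h0]

theorem downMap_heightVec (h : ℕ) : downMap (heightVec h) = downVec heightVec h :=
  linearCombination_heightVec (by simp [downVec, partialSum]) h

theorem stepMap_heightVec (h : ℕ) : stepMap (heightVec h) = stepVec (X : ℤ[X]) heightVec h := by
  simp only [stepMap, LinearMap.add_apply, LinearMap.smul_apply, LinearMap.id_apply,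
    downMap_heightVec, downVec, stepVec, partialSum, Finset.sum_range_succ]
  module

open Classical in
theorem colMap_heightVec (hY : IsOneSidedLadder m n Y) (h : ℕ) : colMap Y a (heightVec h) =
    if (a + 1, h) ∈ Y then stepVec (X : ℤ[X]) heightVec h else 0 := by
  refine linearCombination_heightVec ?_ h
  have := fun h => (hY.pos (p := (a + 1, 0)) h).2.1
  simp only [nonpos_iff_eq_zero, one_ne_zero, imp_false] at this
  simp [this]

theorem stepVec_heightVec (g : ℕ) : stepVec (X : ℤ[X]) heightVec g =
    ∑ h ∈ Finset.Icc 1 g, stepWeight (X : ℤ[X]) g h • heightVec h := by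
  have := sum_stepWeight_smul (X : ℤ[X]) heightVec (Nat.zero_le g)
  rw [sum_Icc_add_left (Nat.zero_le g)] at this
  simpa [partialSum] using this.symm

theorem pathVec_succ (hY : IsOneSidedLadder m n Y) {i : ℕ} (hi : i + 1 ≤ a) :
    pathVec Y n (a + 1) i = colMap Y a (pathVec Y n a i) := by
  classical
  have h1 : ∀ h ∈ Finset.Icc 1 n, pathPoly Y (i + 1, n) (a + 1, h) • heightVec h =
      ∑ g ∈ (Finset.Icc h n).filter (fun g => (a + 1, g) ∈ Y),
        (stepWeight X g h * pathPoly Y (i + 1, n) (a, g)) • heightVec h := by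
    intro h hh
    rw [pathPoly_succ hY (by simp) le_rfl hi (Finset.mem_Icc.1 hh).1, Finset.sum_smul]
  rw [pathVec, Finset.sum_congr rfl h1, pathVec, map_sum, Finset.sum_comm'
    (t' := (Finset.Icc 1 n).filter (fun g => (a + 1, g) ∈ Y)) (s' := fun g => Finset.Icc 1 g),
    Finset.sum_filter]
  · refine Finset.sum_congr rfl fun g _ => ?_
    rw [map_smul, colMap_heightVec hY]
    split_ifs
    · rw [stepVec_heightVec, Finset.smul_sum]
      exact Finset.sum_congr rfl fun h _ => by rw [smul_smul, mul_comm]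
    · simp
  · intro h g
    simp only [Finset.mem_Icc, Finset.mem_filter]
    constructor
    · rintro ⟨⟨h1, h2⟩, ⟨h3, h4⟩, h5⟩
      exact ⟨⟨h1, h3⟩, ⟨h1.trans h3, h4⟩, h5⟩
    · rintro ⟨⟨h1, h3⟩, ⟨-, h4⟩, h5⟩
      exact ⟨⟨h1, h3.trans h4⟩, ⟨h3, h4⟩, h5⟩

theorem pathVec_diag (hY : IsOneSidedLadder m n Y) {i : ℕ} (hi : (i + 1, n) ∈ Y) :
    pathVec Y n (i + 1) i = downVec heightVec n := by
  have : ∀ h ∈ Finset.Icc 1 n, pathPoly Y (i + 1, n) (i + 1, h) • heightVec h = heightVec h := by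
    intro h hh
    rw [pathPoly_vertical hY hi (Finset.mem_Icc.1 hh).1 (Finset.mem_Icc.1 hh).2, one_smul]
  rw [pathVec, Finset.sum_congr rfl this, sum_Icc_eq_partialSum_sub _ (by omega), downVec]
  simp [partialSum]

/-- A column reaching the top row has full height, so the ladder imposes no restriction there. -/
theorem colMap_pathVec (hY : IsOneSidedLadder m n Y) (ha : (a + 1, n) ∈ Y) (i : ℕ) :
    colMap Y a (pathVec Y n a i) = stepMap (pathVec Y n a i) := by
  rw [pathVec, map_sum, map_sum]
  refine Finset.sum_congr rfl fun h hh => ?_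
  rw [Finset.mem_Icc] at hh
  rw [map_smul, map_smul, stepMap_heightVec, colMap_heightVec hY,
    if_pos (hY.closed _ ha (a + 1, h) (Nat.le_add_left _ _) hh.1 le_rfl hh.2)]

theorem pathVec_eq_iterate (hY : IsOneSidedLadder m n Y) (i d : ℕ) (ha : (i + 1 + d, n) ∈ Y) :
    pathVec Y n (i + 1 + d) i = (stepMap ^ d) (downVec heightVec n) := by
  induction d with
  | zero => simpa using pathVec_diag hY ha
  | succ d ih =>
    have h1 : (i + 1 + d, n) ∈ Y :=
      hY.closed _ ha _ (by simp; omega) (hY.pos ha).2.1 (by simp) le_rfl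
    rw [← add_assoc, pathVec_succ hY (by omega), colMap_pathVec (a := i + 1 + d) hY ha, ih h1,
      pow_succ', Module.End.mul_apply]

/-- The wedge of the path vectors of the first `k` starting points is a combination of the nested
wedges of end heights, with the polynomials of non-intersecting families as coefficients. -/
def WedgeExpansion (Y : Finset (ℕ × ℕ)) (n k a : ℕ) : Prop :=
  ιMulti ℤ[X] k (fun i => pathVec Y n a i) = (X : ℤ[X]) ^ k.choose 2 •
    ∑ g ∈ strictBelow (fun _ : Fin k => n),
      familyPoly Y (startPt n k) (endPt a g) • nestedWedge (1 - X : ℤ[X]) heightVec k g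

theorem wedgeExpansion_zero : WedgeExpansion Y n 0 0 := by
  have h1 : strictBelow (fun _ : Fin 0 => n) = {fun _ => n} := by
    ext c
    simp [mem_strictBelow, Subsingleton.elim c (fun _ => n), Subsingleton.strictMono]
  have h2 : nonIntersecting Y (startPt n 0) (endPt 0 fun _ : Fin 0 => n) = {fun i => i.elim0} := by
    ext C
    rw [mem_nonIntersecting, Finset.mem_singleton]
    exact ⟨fun _ => Subsingleton.elim _ _, fun _ => ⟨fun i => i.elim0, fun i => i.elim0⟩⟩
  simp [WedgeExpansion, h1, h2, familyPoly, nestedWedge, ιMulti_apply]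

/-- Apply the transfer map to both sides, expand each nested wedge by interlacing, and exchange the
sums to recognise the recursion for disjoint families. -/
theorem WedgeExpansion.succ (hY : IsOneSidedLadder m n Y) (hka : k ≤ a)
    (H : WedgeExpansion Y n k a) : WedgeExpansion Y n k (a + 1) := by
  classical
  have htq : (X : ℤ[X]) + (1 - X) = 1 := by ring
  have h1 : ιMulti ℤ[X] k (fun i => pathVec Y n (a + 1) i) =
      ExteriorAlgebra.map (colMap Y a) (ιMulti ℤ[X] k (fun i => pathVec Y n a i)) := by
    rw [ExteriorAlgebra.map_apply_ιMulti]
    congr 1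
    funext i
    exact pathVec_succ hY (by have := i.2; omega)
  rw [WedgeExpansion, h1, H, map_smul, map_sum]
  congr 1
  have h2 : ∀ g ∈ strictBelow (fun _ : Fin k => n),
      ExteriorAlgebra.map (colMap Y a) (familyPoly Y (startPt n k) (endPt a g) •
        nestedWedge (1 - X : ℤ[X]) heightVec k g) =
      if ∀ i, (a + 1, g i) ∈ Y then ∑ h ∈ Finset.Icc (interlaceLow g) g,
        ((∏ i, stepWeight (X : ℤ[X]) (g i) (h i)) * familyPoly Y (startPt n k) (endPt a g)) •
          nestedWedge (1 - X : ℤ[X]) heightVec k h else 0 := by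
    intro g hg
    have hg := (mem_strictBelow.1 hg).2
    rw [map_smul, map_nestedWedge]
    split_ifs with hgY
    · have h3 : nestedWedge (1 - X : ℤ[X]) (fun h => colMap Y a (heightVec h)) k g =
          nestedWedge (1 - X : ℤ[X]) (stepVec (X : ℤ[X]) heightVec) k g := by
        refine nestedWedge_congr _ fun i h hh => ?_
        by_cases h0 : h = 0
        · simp [h0, stepVec, partialSum]
        · rw [colMap_heightVec hY, if_pos]
          exact hY.closed _ (hgY i) _ (Nat.le_add_left _ _) (Nat.one_le_iff_ne_zero.2 h0) le_rfl hh
      rw [h3, ← interlaceSum_nestedWedge htq _ hg, interlaceSum, Finset.smul_sum]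
      exact Finset.sum_congr rfl fun h _ => by rw [smul_smul, mul_comm]
    · push Not at hgY
      obtain ⟨i, hi⟩ := hgY
      by_cases h0 : g i = 0
      · rw [nestedWedge_eq_zero _ (by simp) h0, smul_zero]
      · obtain ⟨k, rfl⟩ : ∃ k', k = k' + 1 := ⟨k - 1, by have := i.2; omega⟩
        -- One-sidedness enters here: if any height is cut off, so is the largest, and the transfer
        -- map kills the last factor of the nested wedge.
        have hlast : (a + 1, g (Fin.last k)) ∉ Y := fun hl => hi <|
          hY.closed _ hl _ (Nat.le_add_left _ _) (Nat.one_le_iff_ne_zero.2 h0) le_rfl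
            (hg.monotone (Fin.le_last i))
        rw [nestedWedge, colMap_heightVec hY, if_neg hlast, map_zero, mul_zero, smul_zero]
  rw [Finset.sum_congr rfl h2, ← Finset.sum_filter, Finset.sum_comm'
    (t' := strictBelow (fun _ : Fin k => n)) (s' := fun h => (strictBelow fun _ : Fin k => n).filter
      (fun g => (∀ i, (a + 1, g i) ∈ Y) ∧ h ∈ Finset.Icc (interlaceLow g) g))]
  · refine Finset.sum_congr rfl fun h hh => ?_
    rw [← Finset.sum_smul]
    -- The family recursion needs positive heights; the remaining tuples carry a zero nested wedge.
    by_cases h0 : ∃ i, h i = 0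
    · obtain ⟨i, hi⟩ := h0
      rw [nestedWedge_eq_zero _ heightVec_zero hi, smul_zero, smul_zero]
    · push Not at h0
      rw [familyPoly_succ hY (by simp [startPt]) (by simp [startPt])
        (fun i => (Nat.succ_le_of_lt i.2).trans hka) (fun i => Nat.one_le_iff_ne_zero.2 (h0 i))
        (mem_strictBelow.1 hh).2]
  · intro g h
    simp only [Finset.mem_filter, mem_strictBelow, Finset.mem_Icc]
    constructor
    · rintro ⟨⟨⟨h1, h2⟩, h3⟩, h4, h5⟩
      exact ⟨⟨⟨h1, h2⟩, h3, h4, h5⟩, h5.trans h1,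
        strictMono_iff_interlaceLow_le.2 ((interlaceLow_mono h5).trans h4)⟩
    · rintro ⟨⟨⟨h1, h2⟩, h3, h4, h5⟩, -, -⟩
      exact ⟨⟨⟨h1, h2⟩, h3⟩, h4, h5⟩

/-- The index set is a box, because interlacing already forces strict monotonicity. -/
theorem sum_interlaced_snoc {M : Type*} [AddCommMonoid M] {g : Fin k → ℕ}
    (hgn : g ≤ fun _ => n) (F : (Fin (k + 1) → ℕ) → M) :
    ∑ h ∈ (strictBelow fun _ : Fin (k + 1) => n).filter
        (fun h : Fin (k + 1) → ℕ => (Fin.init h : Fin k → ℕ) ∈ Finset.Icc (interlaceLow g) g ∧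
          nextVal g ≤ h (Fin.last k)), F h =
      ∑ h' ∈ Finset.Icc (interlaceLow g) g, ∑ y ∈ Finset.Icc (nextVal g) n, F (Fin.snoc h' y) := by
  have : (strictBelow fun _ : Fin (k + 1) => n).filter
      (fun h : Fin (k + 1) → ℕ => (Fin.init h : Fin k → ℕ) ∈ Finset.Icc (interlaceLow g) g ∧
          nextVal g ≤ h (Fin.last k)) =
      Finset.Icc (Fin.snoc (interlaceLow g) (nextVal g) : Fin (k + 1) → ℕ) (Fin.snoc g n) := by
    ext h
    simp only [Finset.mem_filter, mem_strictBelow, Finset.mem_Icc, le_iff_init_le (p := k),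
      Fin.init_snoc, Fin.snoc_last, strictMono_iff_init (p := k)]
    constructor
    · rintro ⟨⟨⟨h1, h2⟩, h3, h4⟩, ⟨h5, h6⟩, h7⟩
      exact ⟨⟨h5, h7⟩, h6, h2⟩
    · rintro ⟨⟨h5, h7⟩, h6, h2⟩
      exact ⟨⟨⟨h6.trans hgn, h2⟩, strictMono_iff_interlaceLow_le.2
        ((interlaceLow_mono h6).trans h5), (nextVal_mono h6).trans h7⟩, ⟨h5, h6⟩, h7⟩
  rw [this, sum_Icc_snoc]
  simp

/-- The new last entry is summed without weight, giving S(n+1) - S(`nextVal g`), and the second term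
is annihilated. -/
theorem sum_interlaced_nestedWedge {g : Fin k → ℕ} (hgn : g ≤ fun _ => n) (hg : StrictMono g) :
    ∑ h ∈ (strictBelow fun _ : Fin (k + 1) => n).filter
        (fun h : Fin (k + 1) → ℕ => (Fin.init h : Fin k → ℕ) ∈ Finset.Icc (interlaceLow g) g ∧
          nextVal g ≤ h (Fin.last k)),
      (∏ i, stepWeight (X : ℤ[X]) (g i) (Fin.init h i)) •
        nestedWedge (1 - X : ℤ[X]) heightVec (k + 1) h =
      nestedWedge (1 - X : ℤ[X]) (downVec heightVec) k g * ι ℤ[X] (downVec heightVec n) := by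
  have htq : (X : ℤ[X]) + (1 - X) = 1 := by ring
  have hnext : nextVal g ≤ n + 1 := by
    cases k with
    | zero => simp
    | succ k =>
      rw [nextVal_succ]
      exact Nat.succ_le_succ (hgn _)
  rw [sum_interlaced_snoc hgn]
  simp only [nestedWedge, Fin.init_snoc, Fin.snoc_last, ← Finset.mul_sum,
    ← map_sum, ← smul_mul_assoc]
  rw [sum_Icc_eq_partialSum_sub _ hnext, ← Finset.sum_mul]
  refine (congrArg (· * _) (interlaceSum_dampedSum_nestedWedge htq heightVec hg)).trans ?_
  rw [map_sub, mul_sub, nestedWedge_downVec_mul, sub_zero, downVec]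

theorem WedgeExpansion.diag_succ (hY : IsOneSidedLadder m n Y) (hk : (k + 1, n) ∈ Y)
    (H : WedgeExpansion Y n k k) : WedgeExpansion Y n (k + 1) (k + 1) := by
  classical
  -- The i-th path (0-based) starts in column i + 1, so at column k its vector is the iterate k - 1
  -- - i.
  let f : ℕ → ℕ →₀ ℤ[X] := fun j => (stepMap ^ j) (downVec heightVec n)
  have hf : ∀ i : Fin k, pathVec Y n k i = f (k - 1 - i) := by
    intro i
    have hi : (i : ℕ) + 1 + (k - 1 - i) = k := by have := i.2; omega
    have hkY : (k, n) ∈ Y :=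
      hY.closed _ hk _ (by have := i.2; simp only; omega) (hY.pos hk).2.1 (by simp) le_rfl
    have := pathVec_eq_iterate hY i (k - 1 - i) (by rw [hi]; exact hkY)
    rw [hi] at this
    exact this
  have hgrow := ιMulti_iterate_mul (t := (X : ℤ[X])) (q := 1 - X) (T := stepMap) (E := downMap)
    (fun v => by simp [stepMap]) (f := f)
    (fun j => by simp only [f, pow_succ', Module.End.mul_apply]) k
  have h1 : ∀ i : Fin k, pathVec Y n (k + 1) i.castSucc = stepMap (f (k - 1 - i)) := by
    intro i
    rw [Fin.val_castSucc, pathVec_succ hY i.2, colMap_pathVec hY hk, hf]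
  have h2 : ιMulti ℤ[X] k (fun i => downMap (f (k - 1 - i))) =
      ExteriorAlgebra.map downMap (ιMulti ℤ[X] k (fun i => pathVec Y n k i)) := by
    rw [ExteriorAlgebra.map_apply_ιMulti]
    congr 1
    funext i
    simp [hf]
  have h3 : pathVec Y n (k + 1) (Fin.last k) = f 0 := pathVec_diag hY hk
  -- The k new factors t raise the exponent from k choose 2 to k + 1 choose 2.
  rw [WedgeExpansion, ιMulti_succ_last, h3, funext h1, hgrow, h2, H, map_smul, smul_mul_assoc,
    smul_smul, ← pow_add, Nat.choose_succ_succ' k 1, Nat.choose_one_right, map_sum, Finset.sum_mul]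
  congr 1
  have h4 : ∀ h ∈ strictBelow (fun _ : Fin (k + 1) => n),
      familyPoly Y (startPt n (k + 1)) (endPt (k + 1) h) •
        nestedWedge (1 - X : ℤ[X]) heightVec (k + 1) h =
      ∑ g ∈ (strictBelow fun _ : Fin k => n).filter
        (fun g => (Fin.init h : Fin k → ℕ) ∈ Finset.Icc (interlaceLow g) g ∧
          nextVal g ≤ h (Fin.last k)),
        familyPoly Y (startPt n k) (endPt k g) •
          ((∏ i, stepWeight (X : ℤ[X]) (g i) (Fin.init h i)) •
            nestedWedge (1 - X : ℤ[X]) heightVec (k + 1) h) := by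
    intro h hh
    obtain ⟨hhn, hh⟩ := mem_strictBelow.1 hh
    by_cases h0 : ∃ i, h i = 0
    · obtain ⟨i, hi⟩ := h0
      simp [nestedWedge_eq_zero _ heightVec_zero hi]
    · push Not at h0
      rw [familyPoly_startPt_succ hY hk hh (fun i => Nat.one_le_iff_ne_zero.2 (h0 i)) (hhn _),
        Finset.sum_smul, Finset.sum_filter, Finset.sum_filter]
      refine Finset.sum_congr rfl fun g hg => ?_
      by_cases hgY : ∀ i, (k + 1, g i) ∈ Y
      · simp only [hgY, implies_true, true_and, ite_and, smul_smul]
        split_ifs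
        · rw [one_mul, mul_comm]
        · simp
        · rfl
      · have hw : familyPoly Y (startPt n k) (endPt k g) = 0 := by
          push Not at hgY
          obtain ⟨i, hi⟩ := hgY
          refine familyPoly_eq_zero (i := i) fun hmem => hi ?_
          exact hY.closed _ hk _ (Nat.le_add_left _ _) (hY.pos hmem).2.1 le_rfl
            ((mem_strictBelow.1 hg).1 i)
        simp [hw]
  rw [Finset.sum_congr rfl h4, Finset.sum_comm' (t' := strictBelow (fun _ : Fin k => n))
    (s' := fun g => (strictBelow fun _ : Fin (k + 1) => n).filter
      (fun h : Fin (k + 1) → ℕ => (Fin.init h : Fin k → ℕ) ∈ Finset.Icc (interlaceLow g) g ∧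
          nextVal g ≤ h (Fin.last k)))]
  · refine Finset.sum_congr rfl fun g hg => ?_
    obtain ⟨hgn, hg⟩ := mem_strictBelow.1 hg
    rw [← Finset.smul_sum, sum_interlaced_nestedWedge hgn hg, map_smul, map_nestedWedge,
      smul_mul_assoc, funext downMap_heightVec]
    rfl
  · intro h g
    simp only [Finset.mem_filter]
    tauto

theorem wedgeExpansion_diag (hY : IsOneSidedLadder m n Y) (hk : ∀ i < k, (i + 1, n) ∈ Y) :
    WedgeExpansion Y n k k := by
  induction k with
  | zero => exact wedgeExpansion_zero
  | succ k ih => exact (ih fun i hi => hk i (by omega)).diag_succ hY (hk k (Nat.lt_succ_self k))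

theorem wedgeExpansion_of_le (hY : IsOneSidedLadder m n Y) (hk : ∀ i < k, (i + 1, n) ∈ Y)
    (hka : k ≤ a) : WedgeExpansion Y n k a := by
  induction a, hka using Nat.le_induction with
  | base => exact wedgeExpansion_diag hY hk
  | succ a hka ih => exact ih.succ hY hka

end Transfer

/-! ### Reading off the determinant -/

section Evaluation

open ExteriorAlgebra

variable {r : ℕ}

/-- The linear form on the exterior algebra that sends a wedge of `r` vectors to the determinant of
their coordinates at `b`. -/
noncomputable def minorForm (b : Fin r → ℕ) : ExteriorAlgebra ℤ[X] (ℕ →₀ ℤ[X]) →ₗ[ℤ[X]] ℤ[X] :=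
  liftAlternating (Pi.single r (Matrix.detRowAlternating.compLinearMap
    (LinearMap.pi fun j => Finsupp.lapply (b j))))

theorem minorForm_ιMulti (b : Fin r → ℕ) (v : Fin r → ℕ →₀ ℤ[X]) :
    minorForm b (ιMulti ℤ[X] r v) = (Matrix.of fun i j => v i (b j)).det := by
  rw [minorForm, liftAlternating_apply_ιMulti, Pi.single_eq_same]
  rfl

theorem eq_of_strictMono_of_forall_exists {b h : Fin r → ℕ} (hb : StrictMono b)
    (hh : StrictMono h) (H : ∀ i, ∃ j, h i = b j) : h = b := by
  have hsub : Finset.univ.image h ⊆ Finset.univ.image b := by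
    intro y hy
    obtain ⟨i, -, rfl⟩ := Finset.mem_image.1 hy
    obtain ⟨j, hj⟩ := H i
    exact Finset.mem_image.2 ⟨j, Finset.mem_univ j, hj.symm⟩
  have heq := Finset.eq_of_subset_of_card_le hsub (by
    rw [Finset.card_image_of_injective _ hb.injective,
      Finset.card_image_of_injective _ hh.injective])
  have hrange : Set.range h = Set.range b := by
    simpa using congrArg (fun s : Finset ℕ => (s : Set ℕ)) heq
  exact (StrictMono.range_inj hh hb).1 hrange

/-- Distinct increasing tuples of equal length have different ranges, which produces a zero row. -/
theorem minorForm_heightVec {b h : Fin r → ℕ} (hb : StrictMono b) (hb1 : ∀ i, 1 ≤ b i)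
    (hh : StrictMono h) :
    minorForm b (ιMulti ℤ[X] r fun i => heightVec (h i)) = if h = b then 1 else 0 := by
  have hentry : ∀ i j, heightVec (h i) (b j) = if h i = b j then 1 else 0 := by
    intro i j
    have := hb1 j
    by_cases h0 : h i = 0
    · rw [h0, heightVec_zero, if_neg (by omega)]
      rfl
    · rw [heightVec, if_neg h0, Finsupp.single_apply]
  rw [minorForm_ιMulti]
  simp only [hentry]
  split_ifs with e
  · subst e
    have : (Matrix.of fun i j : Fin r => if h i = h j then (1 : ℤ[X]) else 0) = 1 := by
      ext1 i j
      simp [Matrix.one_apply, hb.injective.eq_iff]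
    rw [this, Matrix.det_one]
  · obtain ⟨i, hi⟩ : ∃ i, ∀ j, h i ≠ b j := by
      by_contra hcon
      push Not at hcon
      exact e (eq_of_strictMono_of_forall_exists hb hh hcon)
    exact Matrix.det_eq_zero_of_row_eq_zero i fun j => by simp [hi j]

theorem minorForm_nestedWedge {b g : Fin r → ℕ} (hb : StrictMono b) (hb1 : ∀ i, 1 ≤ b i)
    (hg : StrictMono g) : minorForm b (nestedWedge (1 - X : ℤ[X]) heightVec r g) =
      (coeffA r b g : ℤ[X]) * (1 - X) ^ (∑ i, (g i - b i)) := by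
  rw [nestedWedge_eq_sum_coeffA _ _ hg, map_sum, Finset.sum_eq_single b]
  · rw [map_smul, minorForm_heightVec hb hb1 hb, if_pos rfl, smul_eq_mul, mul_one]
  · intro h hh hne
    rw [map_smul, minorForm_heightVec hb hb1 (mem_strictBelow.1 hh).2, if_neg hne, smul_zero]
  · intro hbg
    have : coeffA r b g = 0 := by
      by_contra h0
      exact hbg (mem_strictBelow.2 ⟨le_of_coeffA_ne_zero _ _ _ h0, hb⟩)
    simp [this]

theorem pathVec_apply {Y : Finset (ℕ × ℕ)} {n a i y : ℕ} (hy1 : 1 ≤ y) (hyn : y ≤ n) :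
    pathVec Y n a i y = pathPoly Y (i + 1, n) (a, y) := by
  rw [pathVec, Finsupp.finsetSum_apply, Finset.sum_eq_single y]
  · rw [heightVec, if_neg (by omega)]
    simp
  · intro h hh hne
    have := (Finset.mem_Icc.1 hh).1
    rw [heightVec, if_neg (by omega)]
    simp [hne]
  · intro h
    exact absurd (Finset.mem_Icc.2 ⟨hy1, hyn⟩) h

theorem ladderWTilde_eq {m n : ℕ} {Y : Finset (ℕ × ℕ)} (hY : IsOneSidedLadder m n Y)
    {b : Fin r → ℕ} (hb : StrictMono b) (hr : r ≤ m) (hP : ∀ i, startPt n r i ∈ Y)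
    (hQ : ∀ i, endPt m b i ∈ Y) :
    ladderWTilde Y n m b = X ^ r.choose 2 * ∑ g ∈ strictBelow (fun _ : Fin r => n),
      (coeffA r b g : ℤ[X]) * (1 - X) ^ (∑ i, (g i - b i)) * ladderW Y n m g := by
  have hpos : ∀ i, 1 ≤ b i ∧ b i ≤ n := fun i => (hY.pos (hQ i)).2
  have hexp : WedgeExpansion Y n r m :=
    wedgeExpansion_of_le hY (fun i hi => hP ⟨i, hi⟩) hr
  have hdet := congrArg (minorForm b) hexp
  rw [minorForm_ιMulti, map_smul, map_sum, smul_eq_mul] at hdet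
  have hleft : ladderWTilde Y n m b =
      (Matrix.of fun i j : Fin r => pathVec Y n m i (b j)).det := by
    rw [ladderWTilde]
    congr 2
    funext i j
    rw [pathVec_apply (hpos j).1 (hpos j).2]
    rfl
  rw [hleft, hdet]
  congr 1
  refine Finset.sum_congr rfl fun g hg => ?_
  rw [map_smul, minorForm_nestedWedge hb (fun i => (hpos i).1) (mem_strictBelow.1 hg).2,
    smul_eq_mul, mul_comm, ladderW]

/-- Heights above n lie outside Y, so those terms vanish. -/
theorem finsum_ladderW {m n : ℕ} {Y : Finset (ℕ × ℕ)} (hY : IsOneSidedLadder m n Y)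
    (f : (Fin r → ℕ) → ℤ[X]) :
    ∑ᶠ c ∈ incTuples r, f c * ladderW Y n m c =
      ∑ g ∈ strictBelow (fun _ : Fin r => n), f g * ladderW Y n m g := by
  refine finsum_mem_eq_sum_of_inter_support_eq _ ?_
  ext c
  simp only [Set.mem_inter_iff, Finset.mem_coe, mem_strictBelow, and_congr_left_iff]
  intro hc
  refine ⟨fun hs => ⟨fun i => ?_, hs⟩, fun hs => hs.2⟩
  by_contra hi
  refine hc ?_
  have hzero : ladderW Y n m c = 0 :=
    familyPoly_eq_zero (i := i) fun hmem => hi (hY.pos hmem).2.2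
  simp only [hzero, mul_zero]

theorem T_neg_mul_toLaurent_X_pow_mul (d : ℕ) (p : ℤ[X]) :
    LaurentPolynomial.T (-(d : ℤ)) * toLaurent (X ^ d * p) = toLaurent p := by
  rw [map_mul, toLaurent_X_pow, ← mul_assoc, ← LaurentPolynomial.T_add]
  simp

theorem eq_of_coeffA_ne_zero {b c : Fin r → ℕ} (hbi : ∀ i, b i = (i : ℕ) + 1) (hc : StrictMono c)
    (h : coeffA r b c ≠ 0) : c = b := by
  refine le_antisymm ?_ (le_of_coeffA_ne_zero _ _ _ h)
  cases r with
  | zero => exact fun i => i.elim0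
  | succ l =>
    have hlast : c (Fin.last l) = l + 1 := by
      rw [coeffA_succ] at h
      split_ifs at h with e
      · rw [← e, hbi, Fin.val_last]
      · exact absurd rfl h
    -- The last entries agree, and a strictly increasing tuple falls by at least 1 per step down
    -- from there.
    have key : ∀ i : Fin (l + 1), c i ≤ (i : ℕ) + 1 := by
      intro i
      induction i using Fin.reverseInduction with
      | last => rw [hlast, Fin.val_last]
      | cast i ih =>
        have h1 : c i.castSucc < c i.succ := hc i.castSucc_lt_succ
        rw [Fin.val_succ] at ih
        rw [Fin.val_castSucc]
        omega
    intro i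
    rw [hbi]
    exact key i

end Evaluation

/-! ### The theorem -/

theorem theorem4p2 (m n r : ℕ) (hr : 1 ≤ r) (Y : Finset (ℕ × ℕ)) (hY : IsOneSidedLadder m n Y)
    (b : Fin r → ℕ) (hb : b ∈ incTuples r)
    (hP : ∀ i, startPt n r i ∈ Y) (hQ : ∀ i, endPt m b i ∈ Y) :
    LaurentPolynomial.T (-(r.choose 2 : ℤ)) * Polynomial.toLaurent (ladderWTilde Y n m b) =
        Polynomial.toLaurent
          (∑ᶠ c ∈ incTuples r,
            (coeffA r b c : ℤ[X]) * (1 - X) ^ (∑ i, (c i - b i)) * ladderW Y n m c) ∧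
      ((∀ i, b i = (i : ℕ) + 1) →
        LaurentPolynomial.T (-(r.choose 2 : ℤ)) * Polynomial.toLaurent (ladderWTilde Y n m b) =
          Polynomial.toLaurent (ladderW Y n m b)) := by
  have hb' : StrictMono b := hb
  have hrm : r ≤ m := by
    have h1 := hY.subset_rect (hP ⟨r - 1, by omega⟩)
    simp only [startPt, Finset.mem_product, Finset.mem_Icc] at h1
    omega
  rw [ladderWTilde_eq hY hb' hrm hP hQ, T_neg_mul_toLaurent_X_pow_mul, finsum_ladderW hY]
  refine ⟨rfl, fun hbi => ?_⟩
  rw [Finset.sum_eq_single b]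
  · simp [coeffA_self r hb']
  · intro c hc hne
    have : coeffA r b c = 0 := by
      by_contra h0
      exact hne (eq_of_coeffA_ne_zero hbi (mem_strictBelow.1 hc).2 h0)
    simp [this]
  · intro h
    exact absurd (mem_strictBelow.2 ⟨fun i => (hY.pos (hQ i)).2.2, hb'⟩) h
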